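/- **Hypotheses.** Let $X_1,X_2,\dots$ be i.i.d. random vectors in $\mathbb R^d$ with common density $p$, and let $f:\mathbb R^d\to\mathbb R$ be measurable. Assume that $f(X_1)$ has a bounded density $p_f$ on $\mathbb R$, that $\phi_f(t):=E\,e^{tf(X_1)}$ is finite in a neighbourhood of $0$, and that $$p_f(x)=c\,\exp\bigl(-(g(x)-q(x))\bigr)\qquad (x>0)$$ for some constant $c>0$, where $g$ is positive and differentiable on $(0,\infty)$, $g(x)/x\to\infty$ as $x\to\infty$, $h:=g'$ belongs to the class $\mathfrak R$ defined below, and for some $\vartheta>0$ and all large $x$ $$\sup_{v>0,\ |v-x|<\vartheta x}|q(v)|\le \frac1{\sqrt{x\,h(x)}} .$$ **The class $\mathfrak R$.** Let $R_0$ be the set of functions $l$ with $l(x)=\exp\bigl(\int_1^x\frac{\epsilon(u)}u\,du\bigr)$ for all $x\ge1$, where $\epsilon$ is twice differentiable on $[1,\infty)$ and $\epsilon(x)\to0$ as $x\to\infty$. Put $\psi(u):=\inf\{x>0:h(x)\ge u\}$. Then $h\in\mathfrak R$ means that one of the following holds. * ($h\in R_\beta$ for some $\beta>0$) For all large $x$,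 $h(x)=x^\beta l(x)$ with some $l\in R_0$ whose $\epsilon$ satisfies $\limsup_{x\to\infty} x|\epsilon'(x)|<\infty$ and $\limsup_{x\to\infty} x^2|\epsilon''(x)|<\infty$. * ($h\in R_\infty$) $h$ is strictly increasing on $(0,\infty)$ and $\psi\in R_0$, with $\psi(u)\to\infty$ as $u\to\infty$ and with an $\epsilon$ satisfying $x\epsilon'(x)/\epsilon(x)\to0$, $x^2\epsilon''(x)/\epsilon(x)\to0$ as $x\to\infty$ and $\liminf_{x\to\infty}x^\eta\epsilon(x)>0$ for some $\eta\in(0,1/4)$. **The sequence $a_n$.** Let $m_f:=(\log\phi_f)'$ on the interior of the set where $\phi_f$ is finite. Let $a_n\to\infty$ be real numbers. For large $n$ the equation $m_f(t)=a_n$ has a unique solution $t=t_n$ in that interior; assume the growth condition $$\lim_{n\to\infty}\frac{\psi(t_n)^2}{\sqrt{n\,\psi'(t_n)}}=0 .$$ **The two laws.** Let $\Pi_f^{a_n}$ be the probability measure on $\mathbb R^d$ with density $\pi_f^{a_n}(x)=\dfrac{e^{t_nf(x)}}{\phi_f(t_n)}\,p(x)$. Let $P_{f,a_n}$ be the conditional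 law of $(X_1,\dots,X_n)$ given $\sum_{i=1}^n f(X_i)=na_n$. Its $i$-th margin is understood as the probability measure $\nu$ on $\mathbb R^d$ with $$\nu(B)=\lim_{\varepsilon\downarrow0}P\Bigl(X_i\in B\ \Big|\ \bigl|\textstyle\sum_{j=1}^n f(X_j)-na_n\bigr|<\varepsilon\Bigr)\quad\text{for every Borel set } B .$$ **Conclusion.** For all large $n$ these margins exist and are the same measure $\nu_n$ for all $i\le n$, and the variation distance between $\nu_n$ and the tilted law tends to zero: $$\sup_{B}\bigl|\nu_n(B)-\Pi_f^{a_n}(B)\bigr|\longrightarrow0\qquad(n\to\infty),$$ the supremum being over Borel sets $B\subseteq\mathbb R^d$. -/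

import Mathlib

open MeasureTheory ProbabilityTheory Filter Set
open scoped Topology ENNReal

noncomputable section

/-- `l(x) = exp (∫_1^x ε(u)/u du)` for `x ≥ 1`, with `ε` twice differentiable on `[1, ∞)` and
`ε(x) → 0` at infinity. -/
structure IsSlowRep (l ε : ℝ → ℝ) : Prop where
  diff : ∀ x, 1 ≤ x → DifferentiableAt ℝ ε x
  diff_two : ∀ x, 1 ≤ x → DifferentiableAt ℝ (deriv ε) x
  tendsto_zero : Tendsto ε atTop (𝓝 0)
  rep : ∀ x, 1 ≤ x → l x = Real.exp (∫ u in (1 : ℝ)..x, ε u / u)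

/-- The class `R_β`: for large `x`, `h(x) = x^β l(x)` with `l` slowly varying as in `IsSlowRep`,
`limsup x |ε'(x)| < ∞` and `limsup x² |ε''(x)| < ∞`. -/
def ClassRBeta (β : ℝ) (h : ℝ → ℝ) : Prop :=
  0 < β ∧ ∃ l ε : ℝ → ℝ, IsSlowRep l ε ∧
    (∀ᶠ x in atTop, h x = x ^ β * l x) ∧
    (∃ C : ℝ, ∀ᶠ x in atTop, x * |deriv ε x| ≤ C) ∧
    (∃ C : ℝ, ∀ᶠ x in atTop, x ^ 2 * |deriv (deriv ε) x| ≤ C)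

/-- The class `R̃₀`: `l` is slowly varying as in `IsSlowRep`, `l(x) → ∞`, `x ε'(x)/ε(x) → 0`,
`x² ε''(x)/ε(x) → 0`, and `liminf x^η ε(x) > 0` for some `η ∈ (0, 1/4)`. -/
def ClassRTildeZero (l : ℝ → ℝ) : Prop :=
  ∃ ε : ℝ → ℝ, IsSlowRep l ε ∧
    Tendsto l atTop atTop ∧
    Tendsto (fun x => x * deriv ε x / ε x) atTop (𝓝 0) ∧
    Tendsto (fun x => x ^ 2 * deriv (deriv ε) x / ε x) atTop (𝓝 0) ∧
    ∃ η : ℝ, 0 < η ∧ η < 1 / 4 ∧ ∃ c : ℝ, 0 < c ∧ ∀ᶠ x in atTop, c ≤ x ^ η * ε x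

/-- The generalized inverse `ψ(u) = inf {x : h(x) ≥ u}` of a function `h` on `(0, ∞)`. -/
def genInverse (h : ℝ → ℝ) (u : ℝ) : ℝ :=
  sInf {x : ℝ | 0 < x ∧ u ≤ h x}

/-- The class `R_∞`: `h` is strictly increasing on `(0, ∞)` and its inverse belongs to `R̃₀`. -/
def ClassRInfty (h : ℝ → ℝ) : Prop :=
  StrictMonoOn h (Ioi 0) ∧ ClassRTildeZero (genInverse h)

/-- The class `ℜ`, union of all `R_β` (`β > 0`) and of `R_∞`. -/
def ClassR (h : ℝ → ℝ) : Prop :=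
  (∃ β : ℝ, ClassRBeta β h) ∨ ClassRInfty h

/-- The light-tail hypotheses on a function `p` on the line: it is bounded, and on the positive
half-line `p = c exp (-(g - q))`, where `g` is positive and differentiable, `g(x)/x → ∞`,
`h = g'` belongs to `ℜ`, and `sup_{|v - x| < ϑ x} |q(v)| ≤ 1 / √(x h(x))` for large `x`. -/
structure IsLightTailDensity (p g q : ℝ → ℝ) : Prop where
  measurable : Measurable p
  nonneg : ∀ x, 0 ≤ p x
  bounded : ∃ C : ℝ, ∀ x, p x ≤ C
  form : ∃ c : ℝ, 0 < c ∧ ∀ x, 0 < x → p x = c * Real.exp (-(g x - q x))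
  g_pos : ∀ x, 0 < x → 0 < g x
  g_diff : ∀ x, 0 < x → DifferentiableAt ℝ g x
  g_superlinear : Tendsto (fun x => g x / x) atTop atTop
  g_class : ClassR (deriv g)
  q_small : ∃ ϑ : ℝ, 0 < ϑ ∧ ∀ᶠ x in atTop, ∀ v, 0 < v → |v - x| < ϑ * x →
    |q v| ≤ 1 / √(x * deriv g x)

variable {Ω : Type*} [MeasurableSpace Ω]

/-- `m(t) = a` with `m = (d/dt) log E[exp (t Z)]`, for `t` in the interior of the domain of the
moment generating function of `Z`. -/
def IsTiltParam (P : Measure Ω) (Z : Ω → ℝ) (a t : ℝ) : Prop :=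
  t ∈ interior (integrableExpSet Z P) ∧ deriv (cgf Z P) t = a

/-- The solution `t` of `m(t) = a` (it is unique whenever it exists, for nondegenerate `Z`). -/
def tiltParam (P : Measure Ω) (Z : Ω → ℝ) (a : ℝ) : ℝ :=
  sInf {t : ℝ | IsTiltParam P Z a t}

/-- The probability `Π_f^a` on `ℝ^d`, with density `exp (t f(x)) / φ_f(t) * p(x)`, where
`φ_f` is the moment generating function of `Z = f(X₁)` and `m_f(t) = a`. -/
def tiltedLaw {d : ℕ} (P : Measure Ω) (Z : Ω → ℝ) (f p : EuclideanSpace ℝ (Fin d) → ℝ) (a : ℝ) :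
    Measure (EuclideanSpace ℝ (Fin d)) :=
  volume.withDensity fun x =>
    ENNReal.ofReal (Real.exp (tiltParam P Z a * f x) / mgf Z P (tiltParam P Z a) * p x)

variable {F : Type*} [MeasurableSpace F]

/-- `ν` is the conditional law of `Y` given the point event `Z = v`: the limit, on every measurable
set, of the elementary conditional laws of `Y` given `|Z - v| < ε` as `ε ↓ 0`. -/
structure IsCondLawAt (P : Measure Ω) (Y : Ω → F) (Z : Ω → ℝ) (v : ℝ) (ν : Measure F) : Prop where
  prob : IsProbabilityMeasure ν
  lim : ∀ B : Set F, MeasurableSet B →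
    Tendsto (fun ε : ℝ => (cond P {ω | |Z ω - v| < ε}) (Y ⁻¹' B)) (𝓝[>] 0) (𝓝 (ν B))

/-- The conditional law given a point event is unique. -/
theorem IsCondLawAt.unique {P : Measure Ω} {Y : Ω → F} {Z : Ω → ℝ} {v : ℝ} {ν ν' : Measure F}
    (h : IsCondLawAt P Y Z v ν) (h' : IsCondLawAt P Y Z v ν') : ν = ν' :=
  Measure.ext fun B hB => tendsto_nhds_unique (h.lim B hB) (h'.lim B hB)

/-- The variation distance `sup_B |ν(B) - ν'(B)|` over measurable sets `B`. -/
def variationDist (ν ν' : Measure F) : ℝ :=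
  ⨆ B : {B : Set F // MeasurableSet B}, |ν.real B.1 - ν'.real B.1|

end

/-!
The exponent `g` of a density in the class `ℜ` has an eventually monotone derivative: for `R_β` the
representation `h(x) = x^β l(x)` forces it, and for `R_∞` it is part of the definition. So `g` is
convex far out, the perturbation `q` is bounded there, and the density of `f(X₁)` is comparable to
`exp (-g)` (`exists_hasConvexTail`). Everything else rests on this log-concavity of the tail.

* *Envelopes.* For large `t` the function `g(x) - t x` is convex with a minimum far out. If `[l, r]`
  is the interval around the minimizer `b` on which it exceeds its minimum by at most one, then by
  convexity it grows at least linearly, at rate `1 / (r - l)`, away from `b`. The tilted density is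
  therefore at most `K / σ * exp (-|x - b| / σ)` with `σ = r - l` and `K` independent of `t`
  (`HasConvexTail.exists_envelope`). Centred and scaled to variance one, all these densities are
  bounded by a common constant, which also bounds their third absolute moments
  (`exists_isNormalizedDensity_of_envelope`).
* *Local limit theorem.* Over such a class the characteristic functions have a uniform second order
  expansion at the origin, are uniformly bounded away from one elsewhere (a bounded density of
  variance one cannot concentrate near a lattice), and are uniformly square integrable. Fourier
  inversion gives convergence of the densities of normalized sums to the Gaussian density, uniformly
  on the line and over the class (`exists_local_limit_bound`).
* *Conditional law.* If `T` is independent of `Y` and has a bounded continuous density `W`, the law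
  of `Y` given `f(Y) + T = v` has density proportional to `W(v - f(y))` with respect to the law of
  `Y` (`isCondLawAt_of_density`). Exponential tilting commutes with convolution (`convPow_tilt`), so
  the density of the conditional law relative to the tilted law is a ratio of the densities of
  `n - 1` and of `n` tilted and normalized summands. By the local limit theorem this ratio tends to
  one in `L¹` of the tilted law (`tendsto_integral_abs_ratio_sub_one`), and the `L¹` distance bounds
  the variation distance.
-/

namespace GibbsConditioning

/-! ### Probability densities on the line and their convolution powers -/

/-- `w` is a probability density on the line with respect to Lebesgue measure. -/
structure IsProbDensity (w : ℝ → ℝ) : Prop where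
  measurable : Measurable w
  nonneg : ∀ x, 0 ≤ w x
  integrable : Integrable w
  integral_eq_one : ∫ x, w x = 1

/-- The measure on the line with Lebesgue density `w`. -/
noncomputable def densMeasure (w : ℝ → ℝ) : Measure ℝ :=
  volume.withDensity fun x => ENNReal.ofReal (w x)

/-- The density of the sum of `k + 1` independent variables with density `w`, as a function defined
at every point. -/
noncomputable def convPow (w : ℝ → ℝ) : ℕ → ℝ → ℝ
  | 0 => w
  | k + 1 => fun y => ∫ z, w z * convPow w k (y - z)

lemma integral_densMeasure {E : Type*} [NormedAddCommGroup E] [NormedSpace ℝ E] {w : ℝ → ℝ}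
    (hw : Measurable w) (h0 : ∀ x, 0 ≤ w x) (F : ℝ → E) :
    ∫ x, F x ∂(densMeasure w) = ∫ x, w x • F x := by
  rw [densMeasure, integral_withDensity_eq_integral_toReal_smul (by fun_prop) (by simp)]
  simp only [ENNReal.toReal_ofReal (h0 _)]

lemma integrable_densMeasure_iff {w : ℝ → ℝ}
    (hw : Measurable w) (h0 : ∀ x, 0 ≤ w x) {F : ℝ → ℝ} :
    Integrable F (densMeasure w) ↔ Integrable fun x => w x * F x := by
  rw [densMeasure, integrable_withDensity_iff_integrable_smul₀' (by fun_prop) (by simp)]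
  simp only [ENNReal.toReal_ofReal (h0 _), smul_eq_mul]

/-- A measurable nonnegative function is a probability density exactly when the measure it
defines is a probability measure. -/
lemma isProbDensity_of_isProbabilityMeasure {w : ℝ → ℝ} (hw : Measurable w) (h0 : ∀ x, 0 ≤ w x)
    (h : IsProbabilityMeasure (densMeasure w)) : IsProbDensity w := by
  have h1 : ∫⁻ x, ENNReal.ofReal (w x) = 1 := by
    have := h.measure_univ
    rwa [densMeasure, withDensity_apply _ MeasurableSet.univ, setLIntegral_univ] at this
  have hi : Integrable w := by
    refine ⟨hw.aestronglyMeasurable, ?_⟩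
    rw [hasFiniteIntegral_iff_ofReal (ae_of_all _ h0), h1]
    exact ENNReal.one_lt_top
  refine ⟨hw, h0, hi, ?_⟩
  rw [integral_eq_lintegral_of_nonneg_ae (ae_of_all _ h0) hw.aestronglyMeasurable, h1]
  simp

lemma IsProbDensity.isProbabilityMeasure {w : ℝ → ℝ} (hw : IsProbDensity w) :
    IsProbabilityMeasure (densMeasure w) := by
  constructor
  rw [densMeasure, withDensity_apply _ MeasurableSet.univ, setLIntegral_univ,
    ← ofReal_integral_eq_lintegral_ofReal hw.integrable (ae_of_all _ hw.nonneg),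
    hw.integral_eq_one, ENNReal.ofReal_one]

lemma integrable_mul_of_bounded {w v : ℝ → ℝ} {M : ℝ} (hw : Integrable w) (hv : Measurable v)
    (hM : ∀ x, |v x| ≤ M) : Integrable fun x => w x * v x :=
  hw.mul_bdd (c := M) hv.aestronglyMeasurable (ae_of_all _ hM)

lemma measurable_conv {w v : ℝ → ℝ} (hw : Measurable w) (hv : Measurable v) :
    Measurable fun y => ∫ z, w z * v (y - z) := by
  have : StronglyMeasurable (Function.uncurry fun y z : ℝ => w z * v (y - z)) := by
    apply Measurable.stronglyMeasurable
    simp only [Function.uncurry_def]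
    fun_prop
  exact this.integral_prod_right.measurable

/-- The convolution of measures with densities, with the density given by a real integral. -/
lemma densMeasure_conv {w v : ℝ → ℝ} {M : ℝ} (hw : Measurable w) (hw0 : ∀ x, 0 ≤ w x)
    (hwi : Integrable w) (hv : Measurable v) (hv0 : ∀ x, 0 ≤ v x) (hM : ∀ x, v x ≤ M) :
    (densMeasure w).conv (densMeasure v) = densMeasure fun y => ∫ z, w z * v (y - z) := by
  rw [densMeasure, densMeasure, conv_withDensity_eq_lconvolution (by fun_prop)
    (by fun_prop), densMeasure]
  congr 1
  ext y
  rw [lconvolution_def, ofReal_integral_eq_lintegral_ofReal]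
  · congr 1
    ext z
    rw [ENNReal.ofReal_mul (hw0 z)]
    congr 3
    ring
  · exact integrable_mul_of_bounded (M := M) hwi (by fun_prop)
      fun x => by rw [abs_of_nonneg (hv0 _)]; exact hM _
  · exact ae_of_all _ fun z => mul_nonneg (hw0 z) (hv0 _)

lemma IsProbDensity.convPow_aux {w : ℝ → ℝ} (hw : IsProbDensity w) {M : ℝ} (hM : ∀ x, w x ≤ M)
    (k : ℕ) : IsProbDensity (convPow w k) ∧ (∀ x, convPow w k x ≤ M) ∧
      densMeasure (convPow w (k + 1)) = (densMeasure w).conv (densMeasure (convPow w k)) := by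
  induction k with
  | zero =>
    exact ⟨hw, hM, (densMeasure_conv hw.measurable hw.nonneg hw.integrable hw.measurable
      hw.nonneg hM).symm⟩
  | succ k ih =>
    obtain ⟨h1, h2, h3⟩ := ih
    have hd : IsProbDensity (convPow w (k + 1)) := by
      apply isProbDensity_of_isProbabilityMeasure
      · exact measurable_conv hw.measurable h1.measurable
      · exact fun x => integral_nonneg fun z => mul_nonneg (hw.nonneg z) (h1.nonneg _)
      · rw [h3]
        have := hw.isProbabilityMeasure
        have := h1.isProbabilityMeasure
        infer_instance
    have hb : ∀ x, convPow w (k + 1) x ≤ M := by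
      intro x
      calc ∫ z, w z * convPow w k (x - z) ≤ ∫ z, w z * M := by
            refine integral_mono_of_nonneg
              (ae_of_all _ fun z => mul_nonneg (hw.nonneg z) (h1.nonneg _))
              (hw.integrable.mul_const M)
              (ae_of_all _ fun z => mul_le_mul_of_nonneg_left (h2 _) (hw.nonneg z))
        _ = M := by rw [integral_mul_const, hw.integral_eq_one, one_mul]
    exact ⟨hd, hb, (densMeasure_conv hw.measurable hw.nonneg hw.integrable hd.measurable
      hd.nonneg hb).symm⟩

section

variable {w : ℝ → ℝ} {M : ℝ}

lemma IsProbDensity.convPow (hw : IsProbDensity w) (hM : ∀ x, w x ≤ M) (k : ℕ) :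
    IsProbDensity (convPow w k) := (hw.convPow_aux hM k).1

lemma IsProbDensity.convPow_le (hw : IsProbDensity w) (hM : ∀ x, w x ≤ M) (k : ℕ) (x : ℝ) :
    GibbsConditioning.convPow w k x ≤ M := (hw.convPow_aux hM k).2.1 x

lemma IsProbDensity.densMeasure_convPow_succ (hw : IsProbDensity w) (hM : ∀ x, w x ≤ M) (k : ℕ) :
    densMeasure (GibbsConditioning.convPow w (k + 1)) =
      (densMeasure w).conv (densMeasure (GibbsConditioning.convPow w k)) :=
  (hw.convPow_aux hM k).2.2

lemma IsProbDensity.charFun_convPow (hw : IsProbDensity w) (hM : ∀ x, w x ≤ M) (k : ℕ) (u : ℝ) :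
    charFun (densMeasure (GibbsConditioning.convPow w k)) u =
      charFun (densMeasure w) u ^ (k + 1) := by
  induction k with
  | zero => simp [GibbsConditioning.convPow]
  | succ k ih =>
    have := hw.isProbabilityMeasure
    have := (hw.convPow hM k).isProbabilityMeasure
    rw [hw.densMeasure_convPow_succ hM, charFun_conv, ih, pow_succ' _ (k + 1)]

end

/-- Exponential tilting commutes with convolution powers. -/
lemma convPow_tilt (w : ℝ → ℝ) (t c : ℝ) (k : ℕ) (y : ℝ) :
    convPow (fun x => Real.exp (t * x) / c * w x) k y =
      Real.exp (t * y) / c ^ (k + 1) * convPow w k y := by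
  induction k generalizing y with
  | zero => simp [convPow]
  | succ k ih =>
    simp only [convPow, ih]
    rw [← integral_const_mul]
    congr 1
    ext z
    have : Real.exp (t * y) = Real.exp (t * z) * Real.exp (t * (y - z)) := by
      rw [← Real.exp_add]; ring_nf
    rw [this]
    ring

lemma integral_comp_affine {E : Type*} [NormedAddCommGroup E] [NormedSpace ℝ E] (F : ℝ → E)
    {s : ℝ} (hs : 0 < s) (m : ℝ) : s • ∫ x, F (m + s * x) = ∫ x, F x := by
  rw [Measure.integral_comp_mul_left (fun x => F (m + x)) s, integral_add_left_eq_self,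
    smul_smul, abs_of_pos (inv_pos.2 hs), mul_inv_cancel₀ hs.ne', one_smul]

/-- Convolution powers under an affine change of variable. -/
lemma convPow_affine (w : ℝ → ℝ) {s : ℝ} (hs : 0 < s) (m : ℝ) (k : ℕ) (y : ℝ) :
    convPow (fun x => s * w (m + s * x)) k y = s * convPow w k ((k + 1) * m + s * y) := by
  induction k generalizing y with
  | zero => simp [convPow]
  | succ k ih =>
    simp only [convPow, ih]
    rw [← integral_comp_affine (fun z => w z * convPow w k (_ - z)) hs m, smul_eq_mul,
      ← integral_const_mul, ← integral_const_mul]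
    congr 1
    ext z
    have : (k + 1) * m + s * (y - z) = ((k + 1 : ℕ) + 1) * m + s * y - (m + s * z) := by
      push_cast; ring
    rw [this]
    ring

/-- The convolution of an integrable function with a bounded function is continuous. -/
lemma continuous_conv {w v : ℝ → ℝ} (hw : Integrable w) (hv : Measurable v) {M : ℝ}
    (hM : ∀ x, |v x| ≤ M) : Continuous fun y => ∫ z, w z * v (y - z) := by
  have hMn : 0 ≤ M := (abs_nonneg _).trans (hM 0)
  have hvl : LocallyIntegrable v := by
    intro x
    refine ⟨Set.Icc (x - 1) (x + 1), Icc_mem_nhds (by linarith) (by linarith), ?_⟩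
    refine IntegrableOn.of_bound (C := M) (by simp) hv.aestronglyMeasurable
      (ae_of_all _ fun x => by simpa using hM x)
  -- approximate `w` in `L¹` by compactly supported continuous functions
  rw [← continuousOn_univ]
  refine continuousOn_of_uniform_approx_of_continuousOn ?_
  intro U hU
  obtain ⟨ε, hε, hεU⟩ := Metric.mem_uniformity_dist.1 hU
  obtain ⟨φ, hφc, hφ, hφcont, hφi⟩ := hw.exists_hasCompactSupport_integral_sub_le
    (ε := ε / (2 * (M + 1))) (by positivity)
  refine ⟨fun y => ∫ z, φ z * v (y - z), ?_, fun y _ => hεU ?_⟩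
  · exact (hφc.continuous_convolution_left (ContinuousLinearMap.mul ℝ ℝ) hφcont hvl).continuousOn
  · have hvy : ∀ y, Measurable fun z => v (y - z) := fun y => by fun_prop
    rw [Real.dist_eq, ← integral_sub (integrable_mul_of_bounded hw (hvy y) fun x => hM _)
      (integrable_mul_of_bounded hφi (hvy y) fun x => hM _), ← Real.norm_eq_abs]
    calc ‖∫ z, (w z * v (y - z) - φ z * v (y - z))‖
        ≤ ∫ z, ‖w z - φ z‖ * M := by
          refine norm_integral_le_of_norm_le ((hw.sub hφi).norm.mul_const M)
            (ae_of_all _ fun z => ?_)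
          rw [← sub_mul, norm_mul]
          exact mul_le_mul_of_nonneg_left (hM _) (norm_nonneg _)
      _ = (∫ z, ‖w z - φ z‖) * M := integral_mul_const _ _
      _ ≤ ε / (2 * (M + 1)) * M := by gcongr
      _ < ε := by
          rw [div_mul_eq_mul_div, div_lt_iff₀ (by positivity)]
          nlinarith

lemma IsProbDensity.continuous_convPow {w : ℝ → ℝ} {M : ℝ} (hw : IsProbDensity w)
    (hM : ∀ x, w x ≤ M) (k : ℕ) : Continuous (GibbsConditioning.convPow w (k + 1)) :=
  continuous_conv hw.integrable (hw.convPow hM k).measurable fun x => by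
    rw [abs_of_nonneg ((hw.convPow hM k).nonneg x)]; exact hw.convPow_le hM k x

/-- The law of a sum of `k + 1` independent variables with density `w` has density
`convPow w k`. -/
lemma map_sum_eq_densMeasure_convPow {Ω : Type*} [MeasurableSpace Ω] {P : Measure Ω}
    [IsProbabilityMeasure P] {Z : ℕ → Ω → ℝ} (hZ : ∀ i, Measurable (Z i)) (hind : iIndepFun Z P)
    {w : ℝ → ℝ} {M : ℝ} (hw : IsProbDensity w) (hM : ∀ x, w x ≤ M)
    (hlaw : ∀ i, P.map (Z i) = densMeasure w) (k : ℕ) (s : Finset ℕ) (hs : s.card = k + 1) :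
    P.map (fun ω => ∑ j ∈ s, Z j ω) = densMeasure (convPow w k) := by
  induction k generalizing s with
  | zero =>
    obtain ⟨i, rfl⟩ := Finset.card_eq_one.1 hs
    simp only [Finset.sum_singleton]
    exact hlaw i
  | succ k ih =>
    obtain ⟨i, s', hi, rfl, hs'⟩ := Finset.card_eq_succ.1 hs
    have hI : IndepFun (Z i) (∑ j ∈ s', Z j) P :=
      (hind.indepFun_finsetSum_of_notMem hZ hi).symm
    have hfun : (fun ω => ∑ j ∈ insert i s', Z j ω) = Z i + ∑ j ∈ s', Z j := by
      ext ω; simp [Finset.sum_insert hi]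
    have h2 : P.map (∑ j ∈ s', Z j) = densMeasure (convPow w k) := by
      rw [← ih s' hs']; congr 1; ext ω; simp
    rw [hfun, hI.map_add_eq_map_conv_map (hZ i)
      (by fun_prop), hlaw, h2,
      hw.densMeasure_convPow_succ hM]

/-! ### Characteristic functions of bounded densities -/

section

variable {w : ℝ → ℝ} {M : ℝ}

/-- The Parseval identity for finite measures on the line. -/
lemma integral_charFun_comm (μ ν : Measure ℝ) [IsFiniteMeasure μ] [IsFiniteMeasure ν] :
    ∫ u, charFun μ u ∂ν = ∫ x, charFun ν x ∂μ := by
  simp only [charFun_apply_real]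
  rw [integral_integral_swap]
  · congr 1; ext x; congr 1; ext y; ring_nf
  · refine Integrable.of_bound (C := 1) (by fun_prop) (ae_of_all _ fun x => ?_)
    simp only [Function.uncurry_def]
    have : ((x.1 : ℂ) * x.2 * Complex.I) = ((x.1 * x.2 : ℝ) : ℂ) * Complex.I := by push_cast; ring
    rw [this, Complex.norm_exp_ofReal_mul_I]

/-- The squared modulus of the characteristic function is the characteristic function of the
symmetrized law, whose density obeys the same bound. -/
lemma IsProbDensity.exists_symmetrization (hw : IsProbDensity w) (hM : ∀ x, w x ≤ M) :
    ∃ v : ℝ → ℝ, IsProbDensity v ∧ (∀ x, v x ≤ M) ∧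
      ∀ u, charFun (densMeasure v) u = (‖charFun (densMeasure w) u‖ ^ 2 : ℝ) := by
  set w' : ℝ → ℝ := fun x => w (-x) with hw'
  have hd' : IsProbDensity w' := by
    refine ⟨hw.measurable.comp measurable_neg, fun x => hw.nonneg _, hw.integrable.comp_neg, ?_⟩
    rw [hw', integral_neg_eq_self w, hw.integral_eq_one]
  have hM' : ∀ x, w' x ≤ M := fun x => hM _
  have hP := hw.isProbabilityMeasure
  have hP' := hd'.isProbabilityMeasure
  have hconv := densMeasure_conv hw.measurable hw.nonneg hw.integrable hd'.measurable hd'.nonneg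
    hM'
  refine ⟨fun y => ∫ z, w z * w' (y - z), ?_, ?_, ?_⟩
  · apply isProbDensity_of_isProbabilityMeasure (measurable_conv hw.measurable hd'.measurable)
    · exact fun x => integral_nonneg fun z => mul_nonneg (hw.nonneg _) (hd'.nonneg _)
    · rw [← hconv]; infer_instance
  · intro x
    calc ∫ z, w z * w' (x - z) ≤ ∫ z, w z * M := by
          refine integral_mono_of_nonneg
            (ae_of_all _ fun z => mul_nonneg (hw.nonneg z) (hd'.nonneg _))
            (hw.integrable.mul_const M)
            (ae_of_all _ fun z => mul_le_mul_of_nonneg_left (hM' _) (hw.nonneg z))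
      _ = M := by rw [integral_mul_const, hw.integral_eq_one, one_mul]
  · intro u
    have hneg : charFun (densMeasure w') u = charFun (densMeasure w) (-u) := by
      rw [charFun_apply_real, charFun_apply_real, integral_densMeasure hd'.measurable hd'.nonneg,
        integral_densMeasure hw.measurable hw.nonneg,
        ← integral_neg_eq_self (fun x => w x • Complex.exp (((-u : ℝ) : ℂ) * x * Complex.I))]
      congr 1; ext x; simp [hw']
    rw [← hconv, charFun_conv, hneg, charFun_neg, Complex.mul_conj, Complex.normSq_eq_norm_sq]

/-- The energy of the characteristic function of a bounded density, against Gaussian weights: by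
Parseval it is an integral of the symmetrized density against a Gaussian, which the bound on the
density controls. -/
lemma IsProbDensity.integral_normSq_charFun_mul_gaussian_le (hw : IsProbDensity w)
    (hM : ∀ x, w x ≤ M) {V : NNReal} (hV : V ≠ 0) :
    ∫ u, ‖charFun (densMeasure w) u‖ ^ 2 * Real.exp (-u ^ 2 / (2 * V)) ≤ 2 * Real.pi * M := by
  obtain ⟨v, hv, hvM, hvw⟩ := hw.exists_symmetrization hM
  have hVp : (0 : ℝ) < V := by positivity
  have hP := hv.isProbabilityMeasure
  have h := integral_charFun_comm (densMeasure v) (gaussianReal 0 V)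
  simp only [hvw] at h
  rw [integral_complex_ofReal, integral_gaussianReal_eq_integral_smul hV,
    integral_densMeasure hv.measurable hv.nonneg] at h
  have h2 : ∫ x, v x • charFun (gaussianReal 0 V) x =
      ((∫ x, v x * Real.exp (-(V / 2) * x ^ 2) : ℝ) : ℂ) := by
    rw [← integral_complex_ofReal]
    congr 1; ext x
    rw [charFun_gaussianReal]
    simp only [Complex.real_smul]
    push_cast
    congr 2; ring
  rw [h2, Complex.ofReal_inj] at h
  have h3 : ∫ x, v x * Real.exp (-(V / 2) * x ^ 2) ≤ M * √(Real.pi / (V / 2)) := by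
    rw [← integral_gaussian, ← integral_const_mul]
    refine integral_mono_of_nonneg (ae_of_all _ fun x => mul_nonneg (hv.nonneg x)
      (Real.exp_nonneg _)) ((integrable_exp_neg_mul_sq (by positivity)).const_mul M)
      (ae_of_all _ fun x => mul_le_mul_of_nonneg_right (hvM x) (Real.exp_nonneg _))
  rw [← h] at h3
  have h4 : ∫ u, gaussianPDFReal 0 V u • ‖charFun (densMeasure w) u‖ ^ 2 =
      (√(2 * Real.pi * V))⁻¹ *
        ∫ u, ‖charFun (densMeasure w) u‖ ^ 2 * Real.exp (-u ^ 2 / (2 * V)) := by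
    rw [← integral_const_mul]
    congr 1; ext u
    simp only [gaussianPDFReal, smul_eq_mul, sub_zero]
    ring
  rw [h4, inv_mul_le_iff₀ (by positivity)] at h3
  calc _ ≤ _ := h3
    _ = M * (√(2 * Real.pi * V) * √(Real.pi / (V / 2))) := by ring
    _ = M * (2 * Real.pi) := by
        rw [← Real.sqrt_mul (by positivity)]
        congr 1
        rw [Real.sqrt_eq_iff_mul_self_eq (by positivity) (by positivity)]
        field_simp
    _ = _ := by ring

/-- As the variance of the Gaussian weight grows, Fatou's lemma removes it from the energy. -/
lemma IsProbDensity.lintegral_normSq_charFun_le (hw : IsProbDensity w) (hM : ∀ x, w x ≤ M) :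
    ∫⁻ u, ENNReal.ofReal (‖charFun (densMeasure w) u‖ ^ 2) ≤ ENNReal.ofReal (2 * Real.pi * M) := by
  have hP := hw.isProbabilityMeasure
  have hmeas : Measurable (charFun (densMeasure w)) := measurable_charFun
  set F : ℕ → ℝ → ℝ := fun n u =>
    ‖charFun (densMeasure w) u‖ ^ 2 * Real.exp (-u ^ 2 / (2 * ((n + 1 : ℕ) : NNReal)))
  have hF : ∀ n, ∫⁻ u, ENNReal.ofReal (F n u) ≤ ENNReal.ofReal (2 * Real.pi * M) := by
    intro n
    have h0 : (((n + 1 : ℕ) : NNReal)) ≠ 0 := by positivity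
    have hp : (0 : ℝ) < (((n + 1 : ℕ) : NNReal) : ℝ) := by positivity
    rw [← ofReal_integral_eq_lintegral_ofReal]
    · exact ENNReal.ofReal_le_ofReal (hw.integral_normSq_charFun_mul_gaussian_le hM h0)
    · have : Integrable fun u : ℝ => Real.exp (-u ^ 2 / (2 * ((n + 1 : ℕ) : NNReal))) := by
        have := integrable_exp_neg_mul_sq (b := (2 * (((n + 1 : ℕ) : NNReal) : ℝ))⁻¹)
          (by positivity)
        refine this.congr (ae_of_all _ fun u => ?_)
        simp only
        congr 1; ring
      refine this.bdd_mul (c := 1) (by fun_prop) (ae_of_all _ fun u => ?_)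
      rw [Real.norm_eq_abs, abs_of_nonneg (by positivity)]
      exact pow_le_one₀ (norm_nonneg _) (norm_charFun_le_one _)
    · exact ae_of_all _ fun u => by positivity
  have hlim : ∀ u, liminf (fun n => ENNReal.ofReal (F n u)) atTop =
      ENNReal.ofReal (‖charFun (densMeasure w) u‖ ^ 2) := by
    intro u
    apply Tendsto.liminf_eq
    refine ENNReal.tendsto_ofReal ?_
    have h1 : Tendsto (fun n : ℕ => (2 * ((((n + 1 : ℕ) : NNReal)) : ℝ))) atTop atTop := by
      refine Tendsto.const_mul_atTop two_pos ?_
      simp only [NNReal.coe_natCast]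
      exact tendsto_natCast_atTop_atTop.comp (tendsto_add_atTop_nat 1)
    have h2 := (Real.continuous_exp.tendsto _).comp (h1.const_div_atTop (-u ^ 2))
    simpa [F] using h2.const_mul (‖charFun (densMeasure w) u‖ ^ 2)
  calc _ = ∫⁻ u, liminf (fun n => ENNReal.ofReal (F n u)) atTop := by simp only [hlim]
    _ ≤ liminf (fun n => ∫⁻ u, ENNReal.ofReal (F n u)) atTop :=
        lintegral_liminf_le fun n => by fun_prop
    _ ≤ _ := liminf_le_of_le (by isBoundedDefault) fun b hb => by
        obtain ⟨n, hn⟩ := hb.exists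
        exact hn.trans (hF n)

lemma IsProbDensity.integrable_normSq_charFun (hw : IsProbDensity w) (hM : ∀ x, w x ≤ M) :
    Integrable fun u => ‖charFun (densMeasure w) u‖ ^ 2 := by
  have hP := hw.isProbabilityMeasure
  have hmeas : Measurable (charFun (densMeasure w)) := measurable_charFun
  refine ⟨by fun_prop, ?_⟩
  rw [hasFiniteIntegral_iff_ofReal (ae_of_all _ fun u => by positivity)]
  exact (hw.lintegral_normSq_charFun_le hM).trans_lt ENNReal.ofReal_lt_top

/-- The `L²` norm of the characteristic function of a bounded density. -/
lemma IsProbDensity.integral_normSq_charFun_le (hw : IsProbDensity w) (hM : ∀ x, w x ≤ M) :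
    ∫ u, ‖charFun (densMeasure w) u‖ ^ 2 ≤ 2 * Real.pi * M := by
  have hM0 : 0 ≤ M := (hw.nonneg 0).trans (hM 0)
  rw [integral_eq_lintegral_of_nonneg_ae (ae_of_all _ fun u => by positivity)
    (hw.integrable_normSq_charFun hM).1]
  exact ENNReal.toReal_le_of_le_ofReal (by positivity) (hw.lintegral_normSq_charFun_le hM)

lemma IsProbDensity.integrable_charFun_pow (hw : IsProbDensity w) (hM : ∀ x, w x ≤ M) (k : ℕ) :
    Integrable fun u => charFun (densMeasure w) u ^ (k + 2) := by
  have hP := hw.isProbabilityMeasure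
  have hmeas : Measurable (charFun (densMeasure w)) := measurable_charFun
  refine (hw.integrable_normSq_charFun hM).mono' (by fun_prop) (ae_of_all _ fun u => ?_)
  rw [norm_pow]
  exact pow_le_pow_of_le_one (norm_nonneg _) (norm_charFun_le_one _) (by omega)

/-- Fourier inversion for a continuous density with integrable characteristic function. -/
lemma IsProbDensity.eq_integral_charFun (hw : IsProbDensity w) (hc : Continuous w)
    (hi : Integrable (charFun (densMeasure w))) (y : ℝ) :
    (w y : ℂ) = (2 * Real.pi : ℝ)⁻¹ •
      ∫ u : ℝ, Complex.exp (-(u * y * Complex.I)) * charFun (densMeasure w) u := by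
  -- Mathlib's Fourier transform uses the character `exp (-2π i x ξ)`: substitute `u = -2π ξ`
  set F : ℝ → ℂ := fun x => (w x : ℂ)
  have hF : ∀ ξ, FourierTransform.fourier F ξ = charFun (densMeasure w) (-(2 * Real.pi) * ξ) := by
    intro ξ
    rw [Real.fourier_eq', charFun_apply_real, integral_densMeasure hw.measurable hw.nonneg]
    congr 1; ext x
    simp only [F, smul_eq_mul, Complex.real_smul]
    rw [mul_comm]
    congr 2
    simp
    ring
  have hFi : Integrable (FourierTransform.fourier F) := by
    have := hi.comp_mul_left' (R := -(2 * Real.pi)) (by simp [Real.pi_ne_zero])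
    exact this.congr (ae_of_all _ fun ξ => (hF ξ).symm)
  have hinv := congrFun (Continuous.fourierInv_fourier_eq (f := F) (by fun_prop)
    hw.integrable.ofReal hFi) y
  rw [Real.fourierInv_eq'] at hinv
  change F y = _
  rw [← hinv]
  have h := Measure.integral_comp_mul_left
    (fun u : ℝ => Complex.exp (-(u * y * Complex.I)) * charFun (densMeasure w) u)
    (-(2 * Real.pi))
  have habs : |(-(2 * Real.pi))⁻¹| = (2 * Real.pi)⁻¹ := by
    rw [abs_inv, abs_neg, abs_of_pos (by positivity)]
  rw [habs] at h
  rw [← h]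
  congr 1; ext ξ
  rw [hF, smul_eq_mul]
  congr 2
  simp
  ring

/-- Fourier inversion for the convolution powers of a bounded density. -/
lemma IsProbDensity.convPow_eq_integral (hw : IsProbDensity w) (hM : ∀ x, w x ≤ M) (k : ℕ)
    (y : ℝ) :
    (GibbsConditioning.convPow w (k + 1) y : ℂ) = (2 * Real.pi : ℝ)⁻¹ •
      ∫ u : ℝ, Complex.exp (-(u * y * Complex.I)) * charFun (densMeasure w) u ^ (k + 2) := by
  have hfun : charFun (densMeasure (GibbsConditioning.convPow w (k + 1))) =
      fun u => charFun (densMeasure w) u ^ (k + 2) := by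
    ext u; rw [hw.charFun_convPow hM]
  rw [(hw.convPow hM (k + 1)).eq_integral_charFun (hw.continuous_convPow hM k)
    (by rw [hfun]; exact hw.integrable_charFun_pow hM k), hfun]

end

/-! ### Uniform estimates for characteristic functions -/

/-- `w` is a probability density with mean zero, variance one, and `K` bounds both its values and
its third absolute moment. -/
structure IsNormalizedDensity (K : ℝ) (w : ℝ → ℝ) : Prop extends IsProbDensity w where
  le : ∀ x, w x ≤ K
  integrable_third : Integrable fun x => w x * |x| ^ 3
  mean : ∫ x, w x * x = 0
  second : ∫ x, w x * x ^ 2 = 1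
  third_le : ∫ x, w x * |x| ^ 3 ≤ K

section

variable {K : ℝ} {w : ℝ → ℝ}

lemma IsNormalizedDensity.integrable_mul (hw : IsNormalizedDensity K w) {F : ℝ → ℝ}
    (hF : Measurable F) (hb : ∀ x, |F x| ≤ 1 + |x| ^ 3) : Integrable fun x => w x * F x := by
  have h := hw.integrable.add hw.integrable_third
  refine h.mono' (hw.measurable.mul hF).aestronglyMeasurable (ae_of_all _ fun x => ?_)
  rw [Real.norm_eq_abs, abs_mul, abs_of_nonneg (hw.nonneg x)]
  calc w x * |F x| ≤ w x * (1 + |x| ^ 3) := mul_le_mul_of_nonneg_left (hb x) (hw.nonneg x)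
    _ = w x + w x * |x| ^ 3 := by ring

lemma IsNormalizedDensity.integrable_first (hw : IsNormalizedDensity K w) :
    Integrable fun x => w x * x := by
  refine hw.integrable_mul measurable_id fun x => ?_
  have := abs_nonneg x
  change |x| ≤ _
  nlinarith [sq_nonneg (|x| - 1), mul_nonneg this (sq_nonneg (|x| - 1))]

lemma IsNormalizedDensity.integrable_second (hw : IsNormalizedDensity K w) :
    Integrable fun x => w x * x ^ 2 := by
  refine hw.integrable_mul (by fun_prop) fun x => ?_
  rw [abs_pow]
  have := abs_nonneg x
  nlinarith [sq_nonneg (|x| - 1), mul_nonneg this (sq_nonneg (|x| - 1))]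

lemma IsNormalizedDensity.pos (hw : IsNormalizedDensity K w) : 0 < K := by
  by_contra hK
  have h : ∀ x, w x = 0 := fun x => le_antisymm ((hw.le x).trans (not_lt.1 hK)) (hw.nonneg x)
  have := hw.integral_eq_one
  simp [h] at this

end

lemma integrable_smul_exp_mul_I {w φ : ℝ → ℝ} (hw : Integrable w) (hφ : Measurable φ) :
    Integrable fun x => w x • Complex.exp (φ x * Complex.I) := by
  refine hw.mono (hw.aestronglyMeasurable.smul (by fun_prop)) (ae_of_all _ fun x => ?_)
  rw [norm_smul, Complex.norm_exp_ofReal_mul_I, mul_one]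

/-- The second order Taylor bound for `exp (i x)`, valid on the whole line. -/
lemma norm_exp_mul_I_sub_le (x : ℝ) :
    ‖Complex.exp (x * Complex.I) - (1 + x * Complex.I - (x : ℂ) ^ 2 / 2)‖ ≤ 4 * |x| ^ 3 := by
  rcases le_or_gt |x| 1 with hx | hx
  · have h := Complex.norm_exp_sub_sum_le_norm_mul_exp (x * Complex.I) 3
    have hn : ‖(x : ℂ) * Complex.I‖ = |x| := by simp
    rw [hn] at h
    have hs : ∑ m ∈ Finset.range 3, (x * Complex.I) ^ m / (m.factorial : ℂ) =
        1 + x * Complex.I - (x : ℂ) ^ 2 / 2 := by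
      simp [Finset.sum_range_succ, mul_pow, Complex.I_sq]
      ring
    rw [hs] at h
    refine h.trans ?_
    have he : Real.exp |x| ≤ 4 :=
      (Real.exp_le_exp.2 hx).trans (by linarith [Real.exp_one_lt_d9])
    nlinarith [pow_nonneg (abs_nonneg x) 3]
  · have h1 : ‖Complex.exp (x * Complex.I)‖ = 1 := Complex.norm_exp_ofReal_mul_I x
    calc _ ≤ ‖Complex.exp (x * Complex.I)‖ + (‖(1 : ℂ)‖ + ‖(x : ℂ) * Complex.I‖ +
          ‖(x : ℂ) ^ 2 / 2‖) :=
          (norm_sub_le _ _).trans (by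
            gcongr
            exact (norm_sub_le _ _).trans (by gcongr; exact norm_add_le _ _))
      _ = 1 + (1 + |x| + |x| ^ 2 / 2) := by rw [h1]; simp
      _ ≤ 4 * |x| ^ 3 := by
          nlinarith [mul_pos (sub_pos.2 hx) (sub_pos.2 hx), mul_pos (abs_pos.2 (by
            rintro rfl; simp at hx; linarith : x ≠ 0)) (sub_pos.2 hx),
            mul_pos (mul_pos (sub_pos.2 hx) (sub_pos.2 hx)) (sub_pos.2 hx)]

section

variable {K : ℝ} {w : ℝ → ℝ}

/-- Second order expansion of the characteristic function, uniform over normalized densities. -/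
lemma IsNormalizedDensity.norm_charFun_sub_le (hw : IsNormalizedDensity K w) (u : ℝ) :
    ‖charFun (densMeasure w) u - ((1 - u ^ 2 / 2 : ℝ) : ℂ)‖ ≤ 4 * K * |u| ^ 3 := by
  have hexp : Integrable fun x : ℝ => w x • Complex.exp (u * x * Complex.I) := by
    have := integrable_smul_exp_mul_I hw.integrable (φ := fun x => u * x) (by fun_prop)
    simpa using this
  have hpol : Integrable fun x : ℝ => (w x : ℂ) * (1 + (u * x : ℝ) * Complex.I -
      ((u * x : ℝ) : ℂ) ^ 2 / 2) := by
    have h0 := hw.integrable.ofReal (𝕜 := ℂ)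
    have h1 := (hw.integrable_first.ofReal (𝕜 := ℂ)).mul_const (u * Complex.I)
    have h2 := (hw.integrable_second.ofReal (𝕜 := ℂ)).mul_const ((u : ℂ) ^ 2 / 2)
    refine ((h0.add h1).sub h2).congr (ae_of_all _ fun x => ?_)
    simp
    ring
  have hval : ∫ x : ℝ, (w x : ℂ) * (1 + (u * x : ℝ) * Complex.I -
      ((u * x : ℝ) : ℂ) ^ 2 / 2) = ((1 - u ^ 2 / 2 : ℝ) : ℂ) := by
    have h0 : Integrable fun x => ((w x : ℝ) : ℂ) := hw.integrable.ofReal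
    have h1 : Integrable fun x => ((w x * x : ℝ) : ℂ) * (u * Complex.I) :=
      hw.integrable_first.ofReal.mul_const _
    have h2 : Integrable fun x => ((w x * x ^ 2 : ℝ) : ℂ) * ((u : ℂ) ^ 2 / 2) :=
      hw.integrable_second.ofReal.mul_const _
    have e : (fun x : ℝ => (w x : ℂ) * (1 + (u * x : ℝ) * Complex.I -
      ((u * x : ℝ) : ℂ) ^ 2 / 2)) = fun x => ((w x : ℝ) : ℂ) +
        ((w x * x : ℝ) : ℂ) * (u * Complex.I) - ((w x * x ^ 2 : ℝ) : ℂ) * ((u : ℂ) ^ 2 / 2) := by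
      ext x; push_cast; ring
    have h01 : Integrable fun x => ((w x : ℝ) : ℂ) + ((w x * x : ℝ) : ℂ) * (u * Complex.I) :=
      h0.add h1
    rw [e, integral_sub h01 h2, integral_add h0 h1, integral_mul_const,
      integral_mul_const, integral_complex_ofReal, integral_complex_ofReal,
      integral_complex_ofReal, hw.integral_eq_one, hw.mean, hw.second]
    push_cast; ring
  rw [charFun_apply_real, integral_densMeasure hw.measurable hw.nonneg, ← hval,
    ← integral_sub hexp hpol]
  calc _ ≤ ∫ x, 4 * |u| ^ 3 * (w x * |x| ^ 3) := by
        refine norm_integral_le_of_norm_le (hw.integrable_third.const_mul _)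
          (ae_of_all _ fun x => ?_)
        have h := norm_exp_mul_I_sub_le (u * x)
        rw [Complex.real_smul, ← mul_sub, norm_mul, Complex.norm_real, Real.norm_eq_abs,
          abs_of_nonneg (hw.nonneg x), ← Complex.ofReal_mul]
        calc _ ≤ w x * (4 * |u * x| ^ 3) := mul_le_mul_of_nonneg_left h (hw.nonneg x)
          _ = _ := by rw [abs_mul]; ring
    _ = 4 * |u| ^ 3 * ∫ x, w x * |x| ^ 3 := integral_const_mul _ _
    _ ≤ 4 * |u| ^ 3 * K := by gcongr; exact hw.third_le
    _ = _ := by ring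

/-- Near the origin the cubic error is at most half of the quadratic term; hence the size of the
neighbourhood. -/
lemma IsNormalizedDensity.norm_charFun_le_exp (hw : IsNormalizedDensity K w) {u : ℝ}
    (hu : |u| ≤ 1 / (16 * K + 1)) : ‖charFun (densMeasure w) u‖ ≤ Real.exp (-u ^ 2 / 4) := by
  have hK := hw.pos
  have h := hw.norm_charFun_sub_le u
  rw [le_div_iff₀ (by positivity)] at hu
  have hu0 := abs_nonneg u
  have hu1 : |u| ≤ 1 := by nlinarith
  have hsq : u ^ 2 = |u| ^ 2 := (sq_abs u).symm
  have h1 : ‖((1 - u ^ 2 / 2 : ℝ) : ℂ)‖ = 1 - u ^ 2 / 2 := by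
    rw [Complex.norm_real, Real.norm_eq_abs, abs_of_nonneg]
    nlinarith
  have h2 : ‖charFun (densMeasure w) u‖ ≤ 1 - u ^ 2 / 2 + 4 * K * |u| ^ 3 := by
    rw [← h1]
    calc _ = ‖((1 - u ^ 2 / 2 : ℝ) : ℂ) +
          (charFun (densMeasure w) u - ((1 - u ^ 2 / 2 : ℝ) : ℂ))‖ := by congr 1; ring
      _ ≤ _ := (norm_add_le _ _).trans (by gcongr)
  have h3 : 4 * K * |u| ^ 3 ≤ u ^ 2 / 4 := by
    rw [hsq]
    have : 16 * K * |u| ≤ 1 := by nlinarith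
    nlinarith [mul_le_mul_of_nonneg_right this (sq_nonneg |u|)]
  have h4 := Real.add_one_le_exp (-u ^ 2 / 4)
  linarith

end

/-- A tent-like bump of height one around the points of `2π ℤ`, vanishing where
`1 - cos y ≥ 1 / a`. -/
noncomputable def cosBump (a y : ℝ) : ℝ := max 0 (1 - a * (1 - Real.cos y))

lemma continuous_cosBump (a : ℝ) : Continuous (cosBump a) := by
  unfold cosBump; fun_prop

lemma cosBump_nonneg (a y : ℝ) : 0 ≤ cosBump a y := le_max_left _ _

lemma cosBump_periodic (a : ℝ) : Function.Periodic (cosBump a) (2 * Real.pi) := fun y => by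
  simp [cosBump]

lemma tendsto_integral_cosBump :
    Tendsto (fun n : ℕ => ∫ y in (-Real.pi)..(-Real.pi + 2 * Real.pi), cosBump n y) atTop
      (𝓝 0) := by
  have h : Tendsto (fun n : ℕ => ∫ y in (-Real.pi)..(-Real.pi + 2 * Real.pi), cosBump n y) atTop
      (𝓝 (∫ y in (-Real.pi)..(-Real.pi + 2 * Real.pi), (0 : ℝ))) := by
    refine intervalIntegral.tendsto_integral_filter_of_dominated_convergence (fun _ => (1 : ℝ))
      (Eventually.of_forall fun n => (continuous_cosBump _).aestronglyMeasurable)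
      (Eventually.of_forall fun n => ae_of_all _ fun y _ => ?_) (by simp) ?_
    · rw [Real.norm_eq_abs, abs_of_nonneg (cosBump_nonneg _ _)]
      refine max_le zero_le_one ?_
      have : 0 ≤ (n : ℝ) * (1 - Real.cos y) :=
        mul_nonneg n.cast_nonneg (by linarith [Real.cos_le_one y])
      linarith
    · have h0 : ∀ᵐ y : ℝ, y ≠ 0 := by simp [ae_iff]
      have hpi : ∀ᵐ y : ℝ, y ≠ Real.pi := by simp [ae_iff]
      filter_upwards [h0, hpi] with y hy hy' hyI
      rw [uIoc_of_le (by linarith [Real.pi_pos])] at hyI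
      have hc : Real.cos y < 1 := by
        refine lt_of_le_of_ne (Real.cos_le_one y) fun hc => hy ?_
        exact (Real.cos_eq_one_iff_of_lt_of_lt (by linarith [hyI.1, Real.pi_pos])
          (by linarith [hyI.2, Real.pi_pos])).1 hc
      refine tendsto_const_nhds.congr' ?_
      have ht : Tendsto (fun n : ℕ => (n : ℝ) * (1 - Real.cos y)) atTop atTop :=
        tendsto_natCast_atTop_atTop.atTop_mul_const (by linarith)
      filter_upwards [ht.eventually_ge_atTop 1] with n hn
      rw [cosBump, max_eq_left (by linarith)]
  simpa using h

/-- The bumps met by `u x - θ` for `|x| ≤ 2` number at most `u + 1`, and each has width of order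
`1 / u`. -/
lemma integral_cosBump_affine_le (a : ℝ) {u δ : ℝ} (hδ : 0 < δ) (hu : δ ≤ u) (θ : ℝ) :
    ∫ x in (-2 : ℝ)..2, cosBump a (u * x - θ) ≤
      (1 + 1 / δ) * ∫ y in (-Real.pi)..(-Real.pi + 2 * Real.pi), cosBump a y := by
  have hu0 : 0 < u := hδ.trans_le hu
  set I := ∫ y in (-Real.pi)..(-Real.pi + 2 * Real.pi), cosBump a y with hI
  have hI0 : 0 ≤ I := intervalIntegral.integral_nonneg (by linarith [Real.pi_pos])
    fun y _ => cosBump_nonneg _ _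
  have hint : ∀ t₁ t₂, IntervalIntegrable (cosBump a) volume t₁ t₂ := fun t₁ t₂ =>
    (continuous_cosBump a).intervalIntegrable _ _
  rw [intervalIntegral.integral_comp_mul_sub _ hu0.ne', smul_eq_mul]
  set n : ℕ := ⌈4 * u / (2 * Real.pi)⌉₊
  have hn : 4 * u ≤ n * (2 * Real.pi) := by
    rw [← div_le_iff₀ (by positivity)]; exact Nat.le_ceil _
  have hn' : (n : ℝ) ≤ u + 1 := by
    refine (Nat.ceil_lt_add_one (by positivity)).le.trans ?_
    gcongr
    rw [div_le_iff₀ (by positivity)]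
    nlinarith [Real.pi_gt_three]
  have h1 : ∫ y in (u * -2 - θ)..(u * 2 - θ), cosBump a y ≤ n * I := by
    calc _ ≤ ∫ y in (u * -2 - θ)..(u * -2 - θ + (n : ℤ) • (2 * Real.pi)), cosBump a y := by
          refine intervalIntegral.integral_mono_interval le_rfl (by linarith) ?_
            (ae_of_all _ fun y => cosBump_nonneg _ _) (hint _ _)
          simp only [zsmul_eq_mul, Int.cast_natCast]
          linarith
      _ = n * I := by
          rw [(cosBump_periodic a).intervalIntegral_add_zsmul_eq _ _ hint,
            (cosBump_periodic a).intervalIntegral_add_eq _ (-Real.pi)]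
          simp [hI]
  calc u⁻¹ * _ ≤ u⁻¹ * (n * I) := by gcongr
    _ ≤ u⁻¹ * ((u + 1) * I) := by gcongr
    _ = (1 + 1 / u) * I := by field_simp
    _ ≤ _ := by gcongr

section

variable {K : ℝ} {w : ℝ → ℝ}

/-- If `|χ(u)|` were close to one, most of the mass would lie near a lattice of step `2π / u`; a
bounded density with variance one cannot do this. -/
lemma IsNormalizedDensity.one_sub_norm_charFun_ge (hw : IsNormalizedDensity K w) {a : ℝ}
    (ha : 0 ≤ a) {u δ : ℝ} (hδ : 0 < δ) (hu : δ ≤ u) :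
    3 / 4 ≤ a * (1 - ‖charFun (densMeasure w) u‖) +
      K * ((1 + 1 / δ) * ∫ y in (-Real.pi)..(-Real.pi + 2 * Real.pi), cosBump a y) := by
  set z := charFun (densMeasure w) u with hz
  set θ := Complex.arg z with hθ
  have hK := hw.pos
  have hexp : Integrable fun x : ℝ => w x • Complex.exp ((u * x - θ : ℝ) * Complex.I) :=
    integrable_smul_exp_mul_I hw.integrable (by fun_prop)
  -- rotate the characteristic function to the positive axis and take real parts
  have hrot : ((‖z‖ : ℝ) : ℂ) = ∫ x : ℝ, w x • Complex.exp ((u * x - θ : ℝ) * Complex.I) := by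
    have h1 : z = ∫ x : ℝ, w x • Complex.exp (u * x * Complex.I) := by
      rw [hz, charFun_apply_real, integral_densMeasure hw.measurable hw.nonneg]
    have h2 : ((‖z‖ : ℝ) : ℂ) = Complex.exp (-(θ * Complex.I)) * z := by
      conv_rhs => rw [← Complex.norm_mul_exp_arg_mul_I z]
      rw [mul_left_comm, ← Complex.exp_add]
      simp [hθ]
    rw [h2]
    conv_lhs => rw [h1]
    rw [← integral_const_mul]
    congr 1; ext x
    simp only [Complex.real_smul]
    rw [mul_left_comm, ← Complex.exp_add]
    congr 2
    push_cast; ring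
  have hcosi : Integrable fun x => w x * Real.cos (u * x - θ) := by
    refine integrable_mul_of_bounded (M := 1) hw.integrable (by fun_prop)
      fun x => Real.abs_cos_le_one _
  have hcos : ‖z‖ = ∫ x, w x * Real.cos (u * x - θ) := by
    have h := congrArg Complex.re hrot
    have hre : ∀ x : ℝ, w x * Real.cos (u * x - θ) =
        (w x • Complex.exp ((u * x - θ : ℝ) * Complex.I)).re := by
      intro x
      rw [Complex.smul_re, Complex.exp_ofReal_mul_I_re, smul_eq_mul]
    simp only [hre]
    rw [Complex.ofReal_re] at h
    rw [h]
    exact (integral_re hexp).symm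
  have hbump : IntegrableOn (fun x => cosBump a (u * x - θ)) (Ioc (-2) 2) :=
    (((continuous_cosBump a).comp (by fun_prop)).integrableOn_Icc).mono_set Ioc_subset_Icc_self
  have hb2 : Integrable ((Ioc (-2 : ℝ) 2).indicator fun x => cosBump a (u * x - θ)) :=
    hbump.integrable_indicator measurableSet_Ioc
  have hL : Integrable fun x => w x - w x * x ^ 2 * (1 / 4) :=
    hw.integrable.sub (hw.integrable_second.mul_const _)
  have hR : Integrable fun x => a * (w x - w x * Real.cos (u * x - θ)) +
      K * (Ioc (-2 : ℝ) 2).indicator (fun x => cosBump a (u * x - θ)) x :=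
    ((hw.integrable.sub hcosi).const_mul a).add (hb2.const_mul K)
  -- on `|x| ≤ 2` either `1 - cos` is large or the bump is; outside, `1 - x² / 4` is nonpositive
  have hle : ∫ x, (w x - w x * x ^ 2 * (1 / 4)) ≤
      ∫ x, (a * (w x - w x * Real.cos (u * x - θ)) +
      K * (Ioc (-2 : ℝ) 2).indicator (fun x => cosBump a (u * x - θ)) x) := by
    refine integral_mono hL hR fun x => ?_
    have hw0 := hw.nonneg x
    have hc := Real.cos_le_one (u * x - θ)
    have hac : 0 ≤ a * (1 - Real.cos (u * x - θ)) := mul_nonneg ha (by linarith)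
    by_cases hx : x ∈ Ioc (-2 : ℝ) 2
    · simp only [indicator_of_mem hx]
      have h1 : 1 ≤ a * (1 - Real.cos (u * x - θ)) + cosBump a (u * x - θ) := by
        have := le_max_right 0 (1 - a * (1 - Real.cos (u * x - θ)))
        simp only [cosBump]
        linarith
      have h2 := mul_le_mul_of_nonneg_left h1 hw0
      have h3 := mul_le_mul_of_nonneg_right (hw.le x) (cosBump_nonneg a (u * x - θ))
      have h4 : 0 ≤ w x * x ^ 2 := by positivity
      nlinarith
    · simp only [indicator_of_notMem hx, mul_zero, add_zero]
      have hx2 : 4 ≤ x ^ 2 := by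
        rw [mem_Ioc, not_and_or, not_lt, not_le] at hx
        rcases hx with h | h <;> nlinarith
      have := mul_nonneg hw0 hac
      have := mul_le_mul_of_nonneg_left hx2 hw0
      nlinarith
  have hwc : Integrable fun x => a * (w x - w x * Real.cos (u * x - θ)) :=
    (hw.integrable.sub hcosi).const_mul a
  rw [integral_sub hw.integrable (hw.integrable_second.mul_const _), integral_mul_const,
    hw.integral_eq_one, hw.second, integral_add hwc (hb2.const_mul K),
    integral_const_mul, integral_const_mul, integral_sub hw.integrable hcosi,
    hw.integral_eq_one, ← hcos, integral_indicator measurableSet_Ioc,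
    ← intervalIntegral.integral_of_le (by norm_num)] at hle
  have := mul_le_mul_of_nonneg_left (integral_cosBump_affine_le a hδ hu θ) hK.le
  linarith

end

/-- Away from the origin the characteristic functions of normalized densities are uniformly
bounded away from one. -/
lemma exists_norm_charFun_le (K : ℝ) {δ : ℝ} (hδ : 0 < δ) :
    ∃ ρ : ℝ, 0 < ρ ∧ ρ < 1 ∧ ∀ w, IsNormalizedDensity K w → ∀ u, δ ≤ |u| →
      ‖charFun (densMeasure w) u‖ ≤ ρ := by
  -- choose the bumps so thin that the mass near the lattice is at most `1 / 4`
  have h := (tendsto_integral_cosBump.const_mul (K * (1 + 1 / δ)))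
  rw [mul_zero] at h
  obtain ⟨n, hn1, hn⟩ := ((eventually_ge_atTop 1).and
    (h.eventually (gt_mem_nhds (show (0 : ℝ) < 1 / 4 by norm_num)))).exists
  have hn0 : (1 : ℝ) ≤ n := by exact_mod_cast hn1
  refine ⟨1 - 1 / (2 * n), ?_, ?_, fun w hw u hu => ?_⟩
  · rw [sub_pos, div_lt_one (by positivity)]; linarith
  · have : 0 < 1 / (2 * (n : ℝ)) := by positivity
    linarith
  · have hu' : ‖charFun (densMeasure w) u‖ = ‖charFun (densMeasure w) |u|‖ := by
      rcases abs_choice u with h | h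
      · rw [h]
      · rw [h, charFun_neg, RCLike.norm_conj]
    rw [hu']
    have h3 := hw.one_sub_norm_charFun_ge n.cast_nonneg hδ hu
    have h4 : 1 / 2 ≤ n * (1 - ‖charFun (densMeasure w) |u|‖) := by linarith
    rw [le_sub_comm]
    rw [div_le_iff₀ (by positivity)]
    linarith

/-! ### A uniform local limit theorem -/

lemma norm_pow_sub_pow_le_mul {a b : ℂ} (ha : ‖a‖ ≤ 1) (hb : ‖b‖ ≤ 1) (n : ℕ) :
    ‖a ^ n - b ^ n‖ ≤ n * ‖a - b‖ := by
  induction n with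
  | zero => simp
  | succ n ih =>
    have h : a ^ (n + 1) - b ^ (n + 1) = a * (a ^ n - b ^ n) + (a - b) * b ^ n := by ring
    rw [h]
    calc _ ≤ ‖a‖ * ‖a ^ n - b ^ n‖ + ‖a - b‖ * ‖b‖ ^ n := by
          refine (norm_add_le _ _).trans ?_
          rw [norm_mul, norm_mul, norm_pow]
      _ ≤ 1 * (n * ‖a - b‖) + ‖a - b‖ * 1 := by
          gcongr
          exact pow_le_one₀ (norm_nonneg _) hb
      _ = _ := by push_cast; ring

section

variable {K : ℝ} {w : ℕ → ℝ → ℝ} {N : ℕ → ℕ}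

/-- The central limit theorem for characteristic functions, along a sequence of normalized
densities from a fixed class. -/
lemma tendsto_charFun_pow (hw : ∀ᶠ j in atTop, IsNormalizedDensity K (w j))
    (hN : Tendsto N atTop atTop) (u : ℝ) :
    Tendsto (fun j => charFun (densMeasure (w j)) (u / √(N j)) ^ N j) atTop
      (𝓝 ((Real.exp (-u ^ 2 / 2) : ℝ) : ℂ)) := by
  have hNr : Tendsto (fun j => (N j : ℝ)) atTop atTop := tendsto_natCast_atTop_atTop.comp hN
  have hNs : Tendsto (fun j => √(N j : ℝ)) atTop atTop := Real.tendsto_sqrt_atTop.comp hNr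
  rw [tendsto_iff_norm_sub_tendsto_zero]
  have hlim : Tendsto (fun j => 4 * K * |u| ^ 3 / √(N j) + u ^ 4 / 4 / N j) atTop (𝓝 0) := by
    simpa using (hNs.const_div_atTop (4 * K * |u| ^ 3)).add (hNr.const_div_atTop (u ^ 4 / 4))
  refine squeeze_zero' (Eventually.of_forall fun j => norm_nonneg _) ?_ hlim
  filter_upwards [hw, hN.eventually_ge_atTop 1, hNr.eventually_ge_atTop (u ^ 2 / 2)]
    with j hj hN1 hNu
  have hP := hj.isProbabilityMeasure
  have hn : (0 : ℝ) < N j := by exact_mod_cast hN1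
  set n := N j
  set v := u / √n with hv
  have hv2 : v ^ 2 = u ^ 2 / n := by rw [hv, div_pow, Real.sq_sqrt hn.le]
  have hexp : ((Real.exp (-u ^ 2 / 2) : ℝ) : ℂ) = ((Real.exp (-v ^ 2 / 2) : ℝ) : ℂ) ^ n := by
    rw [← Complex.ofReal_pow, ← Real.exp_nat_mul]
    congr 2
    rw [neg_div, neg_div, hv2]
    field_simp
  have h1 : ‖((Real.exp (-v ^ 2 / 2) : ℝ) : ℂ)‖ ≤ 1 := by
    rw [Complex.norm_real, Real.norm_eq_abs, Real.abs_exp, Real.exp_le_one_iff]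
    have := sq_nonneg v
    linarith
  have h2 : ‖charFun (densMeasure (w j)) v - ((Real.exp (-v ^ 2 / 2) : ℝ) : ℂ)‖ ≤
      4 * K * |v| ^ 3 + (v ^ 2 / 2) ^ 2 := by
    have h3 := hj.norm_charFun_sub_le v
    have h4 : ‖(((1 - v ^ 2 / 2 : ℝ) : ℂ)) - ((Real.exp (-v ^ 2 / 2) : ℝ) : ℂ)‖ ≤
        (v ^ 2 / 2) ^ 2 := by
      have h5 : ‖-v ^ 2 / 2‖ ≤ 1 := by
        rw [Real.norm_eq_abs, neg_div, abs_neg, abs_of_nonneg (by positivity), hv2, div_div,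
          div_le_one (by positivity)]
        linarith
      have h6 := Real.norm_exp_sub_one_sub_id_le h5
      rw [← Complex.ofReal_sub, Complex.norm_real, norm_sub_rev]
      calc _ = ‖Real.exp (-v ^ 2 / 2) - 1 - -v ^ 2 / 2‖ := by congr 1; ring
        _ ≤ _ := h6
        _ = _ := by rw [Real.norm_eq_abs, sq_abs]; ring
    exact (norm_sub_le_norm_sub_add_norm_sub _ _ _).trans (add_le_add h3 h4)
  rw [hexp]
  calc _ ≤ n * ‖charFun (densMeasure (w j)) v - ((Real.exp (-v ^ 2 / 2) : ℝ) : ℂ)‖ :=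
        norm_pow_sub_pow_le_mul (norm_charFun_le_one _) h1 n
    _ ≤ n * (4 * K * |v| ^ 3 + (v ^ 2 / 2) ^ 2) := by gcongr
    _ = _ := by
        have hs := Real.sq_sqrt hn.le
        have hs0 : 0 < √(n : ℝ) := Real.sqrt_pos.2 hn
        rw [hv2, hv, abs_div, abs_of_pos hs0]
        generalize √(n : ℝ) = r at *
        rw [← hs]
        field_simp
        ring

/-- `L¹` convergence of the characteristic functions of normalized sums. -/
lemma tendsto_integral_norm_charFun_pow_sub (hw : ∀ᶠ j in atTop, IsNormalizedDensity K (w j))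
    (hN : Tendsto N atTop atTop) :
    Tendsto (fun j => ∫ u, ‖charFun (densMeasure (w j)) (u / √(N j)) ^ N j -
      ((Real.exp (-u ^ 2 / 2) : ℝ) : ℂ)‖) atTop (𝓝 0) := by
  have hNr : Tendsto (fun j => (N j : ℝ)) atTop atTop := tendsto_natCast_atTop_atTop.comp hN
  have hNs : Tendsto (fun j => √(N j : ℝ)) atTop atTop := Real.tendsto_sqrt_atTop.comp hNr
  have hK : 0 < K := hw.exists.choose_spec.pos
  set δ : ℝ := 1 / (16 * K + 1) with hδ
  have hδ0 : 0 < δ := by positivity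
  obtain ⟨ρ, hρ0, hρ1, hρ⟩ := exists_norm_charFun_le K hδ0
  set χ : ℕ → ℝ → ℂ := fun j => charFun (densMeasure (w j)) with hχ
  set G : ℝ → ℂ := fun u => ((Real.exp (-u ^ 2 / 2) : ℝ) : ℂ) with hG
  set A : ℕ → ℝ → ℂ := fun j u =>
    {u : ℝ | |u| ≤ δ * √(N j)}.indicator (fun u => χ j (u / √(N j)) ^ N j) u with hA
  have hAset : ∀ j, MeasurableSet {u : ℝ | |u| ≤ δ * √(N j)} := fun j =>
    measurableSet_le (by fun_prop) measurable_const
  have hgauss : ∀ c : ℝ, 0 < c → Integrable fun u : ℝ => Real.exp (-u ^ 2 / c) := by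
    intro c hc
    refine (integrable_exp_neg_mul_sq (b := c⁻¹) (by positivity)).congr (ae_of_all _ fun u => ?_)
    simp only
    congr 1; ring
  -- the central part, by dominated convergence
  have hcent : Tendsto (fun j => ∫ u, ‖A j u - G u‖) atTop (𝓝 0) := by
    have h0 : Tendsto (fun j => ∫ u, ‖A j u - G u‖) atTop (𝓝 (∫ u : ℝ, (0 : ℝ))) := by
      refine tendsto_integral_filter_of_dominated_convergence
        (fun u => 2 * Real.exp (-u ^ 2 / 4)) ?_ ?_ ((hgauss 4 (by norm_num)).const_mul 2) ?_
      · filter_upwards [hw] with j hj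
        have hP := hj.isProbabilityMeasure
        have hm : Measurable (χ j) := measurable_charFun
        have : Measurable (A j) := Measurable.indicator (by fun_prop) (hAset j)
        have hGm : Measurable G := by fun_prop
        exact (this.sub hGm).norm.aestronglyMeasurable
      · filter_upwards [hw, hN.eventually_ge_atTop 1] with j hj hN1
        refine ae_of_all _ fun u => ?_
        have hn : (0 : ℝ) < N j := by exact_mod_cast hN1
        have h1 : ‖A j u‖ ≤ Real.exp (-u ^ 2 / 4) := by
          by_cases hu : u ∈ {u : ℝ | |u| ≤ δ * √(N j)}
          · simp only [hA, indicator_of_mem hu]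
            have hu' : |u / √(N j)| ≤ 1 / (16 * K + 1) := by
              rw [abs_div, abs_of_nonneg (Real.sqrt_nonneg _),
                div_le_iff₀ (Real.sqrt_pos.2 hn)]
              exact hu
            rw [norm_pow]
            calc _ ≤ Real.exp (-(u / √(N j)) ^ 2 / 4) ^ N j :=
                  pow_le_pow_left₀ (norm_nonneg _) (hj.norm_charFun_le_exp hu') _
              _ = _ := by
                  rw [← Real.exp_nat_mul]
                  congr 1
                  rw [div_pow, Real.sq_sqrt hn.le]
                  field_simp
          · simp only [hA, indicator_of_notMem hu, norm_zero]
            positivity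
        have h2 : ‖G u‖ ≤ Real.exp (-u ^ 2 / 4) := by
          rw [Complex.norm_real, Real.norm_eq_abs, Real.abs_exp, Real.exp_le_exp]
          have := sq_nonneg u
          linarith
        rw [norm_norm]
        linarith [norm_sub_le (A j u) (G u)]
      · refine ae_of_all _ fun u => ?_
        rw [← tendsto_iff_norm_sub_tendsto_zero]
        refine (tendsto_charFun_pow hw hN u).congr' ?_
        filter_upwards [(hNs.const_mul_atTop hδ0).eventually_ge_atTop |u|] with j hj
        have : u ∈ {u : ℝ | |u| ≤ δ * √(N j)} := hj
        simp only [hA, indicator_of_mem this, hχ]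
    simpa using h0
  -- outside the central part two factors keep the integral finite, and the others are at most `ρ`
  have htail : Tendsto (fun j => (N j : ℝ) * ρ ^ N j * (ρ⁻¹ ^ 2 * (2 * Real.pi * K))) atTop
      (𝓝 0) := by
    have := ((tendsto_self_mul_const_pow_of_abs_lt_one (r := ρ)
      (by rwa [abs_of_pos hρ0])).comp hN).mul_const (ρ⁻¹ ^ 2 * (2 * Real.pi * K))
    simpa using this
  have hsum := hcent.add htail
  rw [add_zero] at hsum
  refine squeeze_zero' (Eventually.of_forall fun j => integral_nonneg fun u => norm_nonneg _) ?_
    hsum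
  filter_upwards [hw, hN.eventually_ge_atTop 2] with j hj hN2
  have hP := hj.isProbabilityMeasure
  have hm : Measurable (χ j) := measurable_charFun
  have hn : (0 : ℝ) < N j := by exact_mod_cast (by omega : 0 < N j)
  have hs : 0 < √(N j : ℝ) := Real.sqrt_pos.2 hn
  obtain ⟨k, hk⟩ : ∃ k, N j = k + 2 := ⟨N j - 2, by omega⟩
  have hi2 : Integrable fun u => ‖χ j (u / √(N j))‖ ^ 2 :=
    (hj.integrable_normSq_charFun hj.le).comp_div hs.ne'
  have hi : Integrable fun u => χ j (u / √(N j)) ^ N j := by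
    rw [hk]
    rw [hk] at hs
    exact (hj.integrable_charFun_pow hj.le k).comp_div hs.ne'
  have hAi : Integrable (A j) := hi.indicator (hAset j)
  have hGi : Integrable G := (hgauss 2 (by norm_num)).ofReal
  calc ∫ u, ‖χ j (u / √(N j)) ^ N j - G u‖
      ≤ ∫ u, (‖A j u - G u‖ + ρ ^ k * ‖χ j (u / √(N j))‖ ^ 2) := by
        refine integral_mono_of_nonneg (ae_of_all _ fun u => norm_nonneg _)
          ((hAi.sub hGi).norm.add (hi2.const_mul _)) (ae_of_all _ fun u => ?_)
        by_cases hu : u ∈ {u : ℝ | |u| ≤ δ * √(N j)}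
        · simp only [hA, indicator_of_mem hu]
          have : 0 ≤ ρ ^ k * ‖χ j (u / √(N j))‖ ^ 2 := by positivity
          linarith
        · simp only [hA, indicator_of_notMem hu, zero_sub, norm_neg]
          have hu' : δ ≤ |u / √(N j)| := by
            rw [abs_div, abs_of_pos hs, le_div_iff₀ hs]
            exact (not_le.1 hu).le
          have h1 : ‖χ j (u / √(N j)) ^ N j‖ ≤ ρ ^ k * ‖χ j (u / √(N j))‖ ^ 2 := by
            rw [norm_pow, hk, pow_add]
            rw [hk] at hu'
            gcongr
            exact hρ _ hj _ hu'
          linarith [norm_sub_le (χ j (u / √(N j)) ^ N j) (G u)]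
    _ = (∫ u, ‖A j u - G u‖) + ρ ^ k * ∫ u, ‖χ j (u / √(N j))‖ ^ 2 := by
        have hAG : Integrable fun u => ‖A j u - G u‖ := (hAi.sub hGi).norm
        rw [integral_add hAG (hi2.const_mul _), integral_const_mul]
    _ ≤ (∫ u, ‖A j u - G u‖) + ρ ^ k * (N j * (2 * Real.pi * K)) := by
        gcongr
        rw [Measure.integral_comp_div (fun u => ‖χ j u‖ ^ 2), abs_of_pos hs, smul_eq_mul]
        have h1 : √(N j : ℝ) ≤ N j := by
          rw [Real.sqrt_le_left hn.le]
          have : (1 : ℝ) ≤ N j := by exact_mod_cast (by omega : 1 ≤ N j)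
          nlinarith
        exact mul_le_mul h1 (hj.integral_normSq_charFun_le hj.le)
          (integral_nonneg fun u => by positivity) hn.le
    _ = _ := by
        have : ρ ^ N j = ρ ^ k * ρ ^ 2 := by rw [hk, pow_add]
        rw [this]
        field_simp

lemma gaussianPDFReal_eq_integral (y : ℝ) :
    (gaussianPDFReal 0 1 y : ℂ) = (2 * Real.pi : ℝ)⁻¹ •
      ∫ u : ℝ, Complex.exp (-(u * y * Complex.I)) * ((Real.exp (-u ^ 2 / 2) : ℝ) : ℂ) := by
  have hd : densMeasure (gaussianPDFReal 0 1) = gaussianReal 0 1 := by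
    rw [gaussianReal_of_var_ne_zero _ one_ne_zero]; rfl
  have hp : IsProbDensity (gaussianPDFReal 0 1) := by
    refine isProbDensity_of_isProbabilityMeasure (measurable_gaussianPDFReal _ _)
      (gaussianPDFReal_nonneg _ _) ?_
    rw [hd]; infer_instance
  have hch : charFun (densMeasure (gaussianPDFReal 0 1)) =
      fun u => ((Real.exp (-u ^ 2 / 2) : ℝ) : ℂ) := by
    ext u
    rw [hd, charFun_gaussianReal]
    push_cast
    congr 1
    simp
    ring
  have hint : Integrable fun u : ℝ => ((Real.exp (-u ^ 2 / 2) : ℝ) : ℂ) := by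
    refine ((integrable_exp_neg_mul_sq (b := 2⁻¹) (by positivity)).congr
      (ae_of_all _ fun u => ?_)).ofReal
    simp only
    congr 1; ring
  rw [hp.eq_integral_charFun (by unfold gaussianPDFReal; fun_prop) (by rw [hch]; exact hint), hch]

/-- **Local limit theorem**, uniform over normalized densities: the density of
`(Y₁ + ⋯ + Y_N) / √N` converges to the standard Gaussian density uniformly on the line. -/
theorem exists_local_limit_bound (hw : ∀ᶠ j in atTop, IsNormalizedDensity K (w j))
    (hN : Tendsto N atTop atTop) :
    ∃ e : ℕ → ℝ, Tendsto e atTop (𝓝 0) ∧ ∀ᶠ j in atTop, ∀ y,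
      |√(N j) * convPow (w j) (N j - 1) (√(N j) * y) - gaussianPDFReal 0 1 y| ≤ e j := by
  have hlim := (tendsto_integral_norm_charFun_pow_sub hw hN).const_mul (2 * Real.pi)⁻¹
  rw [mul_zero] at hlim
  refine ⟨_, hlim, ?_⟩
  filter_upwards [hw, hN.eventually_ge_atTop 2] with j hj hN2 y
  have hP := hj.isProbabilityMeasure
  have hn : (0 : ℝ) < N j := by exact_mod_cast (by omega : 0 < N j)
  have hs : 0 < √(N j : ℝ) := Real.sqrt_pos.2 hn
  obtain ⟨k, hk⟩ : ∃ k, N j = k + 2 := ⟨N j - 2, by omega⟩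
  have hk1 : N j - 1 = k + 1 := by omega
  set χ := charFun (densMeasure (w j)) with hχ
  have hm : Measurable χ := measurable_charFun
  have hi : Integrable fun u => χ (u / √(N j)) ^ N j := by
    rw [hk]
    rw [hk] at hs
    exact (hj.integrable_charFun_pow hj.le k).comp_div hs.ne'
  have hG : Integrable fun u : ℝ => ((Real.exp (-u ^ 2 / 2) : ℝ) : ℂ) := by
    refine ((integrable_exp_neg_mul_sq (b := 2⁻¹) (by positivity)).congr
      (ae_of_all _ fun u => ?_)).ofReal
    simp only
    congr 1; ring
  have hosc : ∀ {F : ℝ → ℂ}, Integrable F →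
      Integrable fun u : ℝ => Complex.exp (-(u * y * Complex.I)) * F u := by
    intro F hF
    refine hF.bdd_mul (c := 1) (by fun_prop) (ae_of_all _ fun u => ?_)
    have : -((u : ℂ) * y * Complex.I) = ((-(u * y) : ℝ) : ℂ) * Complex.I := by push_cast; ring
    rw [this, Complex.norm_exp_ofReal_mul_I]
  have h1 : ((√(N j) * convPow (w j) (N j - 1) (√(N j) * y) : ℝ) : ℂ) = (2 * Real.pi : ℝ)⁻¹ •
      ∫ u : ℝ, Complex.exp (-(u * y * Complex.I)) * χ (u / √(N j)) ^ N j := by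
    have h := Measure.integral_comp_div (fun u : ℝ =>
      Complex.exp (-(u * (√(N j) * y : ℝ) * Complex.I)) * χ u ^ N j) √(N j)
    rw [hk1, Complex.ofReal_mul, hj.convPow_eq_integral hj.le k, ← hχ, ← hk]
    rw [abs_of_pos hs] at h
    rw [mul_smul_comm, ← Complex.real_smul, ← h]
    congr 2; ext u
    congr 3
    push_cast
    have : (√(N j : ℝ) : ℂ) ≠ 0 := by exact_mod_cast hs.ne'
    field_simp
  rw [← Real.norm_eq_abs, ← Complex.norm_real, Complex.ofReal_sub, h1,
    gaussianPDFReal_eq_integral, ← smul_sub, ← integral_sub (hosc hi) (hosc hG), norm_smul,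
    Real.norm_eq_abs, abs_of_pos (by positivity)]
  gcongr
  refine norm_integral_le_of_norm_le (hi.sub hG).norm (ae_of_all _ fun u => ?_)
  rw [← mul_sub, norm_mul]
  have : -((u : ℂ) * y * Complex.I) = ((-(u * y) : ℝ) : ℂ) * Complex.I := by push_cast; ring
  rw [this, Complex.norm_exp_ofReal_mul_I, one_mul]

end

/-! ### Convexity of the exponent of a light-tailed density -/

/-- The logarithmic derivative of `x^β l(x)` is `(β + ε(x)) / x`, which is eventually positive. -/
lemma ClassRBeta.exists_monotoneOn {β : ℝ} {h : ℝ → ℝ} (hh : ClassRBeta β h) :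
    ∃ x₀, MonotoneOn h (Ici x₀) := by
  obtain ⟨hβ, l, ε, hl, hform, -, -⟩ := hh
  obtain ⟨x₁, hx₁⟩ := eventually_atTop.1 hform
  obtain ⟨x₂, hx₂⟩ := eventually_atTop.1
    (hl.tendsto_zero.eventually (lt_mem_nhds (show -β < 0 by linarith)))
  set x₀ := max 1 (max x₁ x₂)
  have h1 : 1 ≤ x₀ := le_max_left _ _
  refine ⟨x₀, fun x hx y hy hxy => ?_⟩
  have hx1 : 1 ≤ x := h1.trans hx
  have hy1 : 1 ≤ y := h1.trans hy
  have hcont : ContinuousOn (fun u => ε u / u) (Ici 1) := fun u hu =>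
    ((hl.diff u hu).continuousAt.div continuousAt_id (by
      rintro rfl; exact absurd hu (by norm_num))).continuousWithinAt
  have hint : ∀ a b, 1 ≤ a → 1 ≤ b → IntervalIntegrable (fun u => ε u / u) volume a b :=
    fun a b ha hb => (hcont.mono fun u hu => (le_min ha hb).trans hu.1).intervalIntegrable
  rw [hx₁ x ((le_max_left x₁ x₂).trans ((le_max_right _ _).trans hx)),
    hx₁ y ((le_max_left x₁ x₂).trans ((le_max_right _ _).trans hy)), hl.rep x hx1, hl.rep y hy1,
    Real.rpow_def_of_pos (by linarith), Real.rpow_def_of_pos (by linarith), ← Real.exp_add,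
    ← Real.exp_add, Real.exp_le_exp, ← intervalIntegral.integral_add_adjacent_intervals
    (hint 1 x le_rfl hx1) (hint x y hx1 hy1)]
  have hlow : ∫ u in x..y, (-β) * (1 / u) ≤ ∫ u in x..y, ε u / u := by
    refine intervalIntegral.integral_mono_on hxy ?_ (hint x y hx1 hy1) fun u hu => ?_
    · refine (ContinuousOn.intervalIntegrable fun u hu => ?_)
      have : u ≠ 0 := by
        have : 1 ≤ u := (le_min hx1 hy1).trans hu.1
        linarith
      exact (continuousAt_const.mul (continuousAt_const.div continuousAt_id
        this)).continuousWithinAt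
    · have hu0 : 0 < u := by linarith [hu.1]
      have := hx₂ u ((le_max_right x₁ x₂).trans ((le_max_right _ _).trans (hx.trans hu.1)))
      rw [mul_one_div]
      gcongr
  rw [intervalIntegral.integral_const_mul, integral_one_div_of_pos (by linarith) (by linarith),
    Real.log_div (by linarith) (by linarith)] at hlow
  linarith

lemma ClassR.exists_monotoneOn {h : ℝ → ℝ} (hh : ClassR h) : ∃ x₀, MonotoneOn h (Ici x₀) := by
  rcases hh with ⟨β, hβ⟩ | hinf
  · exact ClassRBeta.exists_monotoneOn hβ
  · exact ⟨1, hinf.1.monotoneOn.mono (Ici_subset_Ioi.2 one_pos)⟩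

/-- Beyond `x₀` the density `p` is comparable to `exp (-g)`, where `g` is convex, nondecreasing and
superlinear. -/
structure HasConvexTail (p g : ℝ → ℝ) (x₀ c₁ c₂ : ℝ) : Prop where
  x₀_pos : 0 < x₀
  c₁_pos : 0 < c₁
  lower : ∀ x, x₀ ≤ x → c₁ * Real.exp (-g x) ≤ p x
  upper : ∀ x, x₀ ≤ x → p x ≤ c₂ * Real.exp (-g x)
  convexOn : ConvexOn ℝ (Ici x₀) g
  monotoneOn : MonotoneOn g (Ici x₀)
  continuousOn : ContinuousOn g (Ici x₀)
  superlinear : Tendsto (fun x => g x / x) atTop atTop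

lemma HasConvexTail.c₂_pos {p g : ℝ → ℝ} {x₀ c₁ c₂ : ℝ} (h : HasConvexTail p g x₀ c₁ c₂) :
    0 < c₂ := by
  have := (h.lower x₀ le_rfl).trans (h.upper x₀ le_rfl)
  exact h.c₁_pos.trans_le (le_of_mul_le_mul_right this (Real.exp_pos _))

/-- In both classes `g'` is eventually nondecreasing, so that `g` is convex far out; and since `g'`
is then bounded below, the perturbation `q` is bounded there. -/
lemma exists_hasConvexTail {p g q : ℝ → ℝ} (hp : IsLightTailDensity p g q) :
    ∃ x₀ c₁ c₂, HasConvexTail p g x₀ c₁ c₂ := by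
  obtain ⟨x₁, hmono⟩ := ClassR.exists_monotoneOn hp.g_class
  obtain ⟨c, hc, hform⟩ := hp.form
  obtain ⟨ϑ, hϑ, hq⟩ := hp.q_small
  obtain ⟨x₂, hx₂⟩ := eventually_atTop.1 hq
  set a := max 1 x₁
  have ha1 : 1 ≤ a := le_max_left _ _
  -- superlinearity forces the derivative to exceed one somewhere, hence everywhere beyond
  obtain ⟨ξ, hξa, hξ⟩ : ∃ ξ, a < ξ ∧ 1 ≤ deriv g ξ := by
    obtain ⟨y, hy, hya⟩ := ((hp.g_superlinear.eventually_ge_atTop (1 + |g a|)).and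
      (eventually_gt_atTop a)).exists
    have hy0 : 0 < y := by linarith
    rw [le_div_iff₀ hy0] at hy
    obtain ⟨ξ, hξ, hd⟩ := exists_deriv_eq_slope g hya
      (fun x hx => (hp.g_diff x (by linarith [hx.1])).continuousAt.continuousWithinAt)
      (fun x hx => (hp.g_diff x (by linarith [hx.1])).differentiableWithinAt)
    refine ⟨ξ, hξ.1, ?_⟩
    rw [hd, le_div_iff₀ (by linarith)]
    nlinarith [abs_nonneg (g a), le_abs_self (g a)]
  have hderiv : ∀ x, ξ ≤ x → 1 ≤ deriv g x := fun x hx => hξ.trans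
    (hmono ((le_max_right _ _).trans hξa.le) ((le_max_right _ _).trans (hξa.le.trans hx)) hx)
  set x₀ := max ξ x₂
  have hx₀ξ : ξ ≤ x₀ := le_max_left _ _
  have hx₀ : 1 ≤ x₀ := by linarith
  have hqb : ∀ x, x₀ ≤ x → |q x| ≤ 1 := by
    intro x hx
    have h1 := hx₂ x ((le_max_right _ _).trans hx) x (by linarith)
      (by rw [sub_self, abs_zero]; exact mul_pos hϑ (by linarith))
    refine h1.trans ?_
    have h2 := hderiv x (hx₀ξ.trans hx)
    have h3 : 1 ≤ √(x * deriv g x) := by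
      rw [Real.one_le_sqrt]
      nlinarith
    exact (div_le_one (by linarith)).2 h3
  have hcont : ContinuousOn g (Ici x₀) := fun x hx =>
    (hp.g_diff x (by linarith [mem_Ici.1 hx])).continuousAt.continuousWithinAt
  have hdiff : DifferentiableOn ℝ g (interior (Ici x₀)) := fun x hx =>
    (hp.g_diff x (by linarith [mem_Ici.1 (interior_subset hx)])).differentiableWithinAt
  refine ⟨x₀, c * Real.exp (-1), c * Real.exp 1, by linarith, by positivity, fun x hx => ?_,
    fun x hx => ?_, ?_, ?_, hcont, hp.g_superlinear⟩
  · rw [hform x (by linarith), mul_assoc, ← Real.exp_add]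
    have := neg_abs_le (q x)
    have := hqb x hx
    gcongr
    linarith
  · rw [hform x (by linarith), mul_assoc, ← Real.exp_add]
    have := le_abs_self (q x)
    have := hqb x hx
    gcongr
    linarith
  · refine MonotoneOn.convexOn_of_deriv (convex_Ici _) hcont hdiff (hmono.mono fun x hx => ?_)
    have : x₀ ≤ x := interior_subset hx
    have : x₁ ≤ a := le_max_right _ _
    simp only [mem_Ici]
    linarith
  · refine monotoneOn_of_deriv_nonneg (convex_Ici _) hcont hdiff fun x hx => ?_
    linarith [hderiv x (hx₀ξ.trans (interior_subset hx))]

/-! ### Exponential envelopes of tilted densities -/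

lemma integrable_abs_pow_mul_exp_neg_abs (k : ℕ) :
    Integrable fun y : ℝ => |y| ^ k * Real.exp (-|y|) := by
  refine ((integrable_inv_one_add_sq).const_mul
    ((k.factorial + (k + 2).factorial : ℝ))).mono' (by fun_prop) (ae_of_all _ fun y => ?_)
  have h1 := Real.pow_div_factorial_le_exp |y| (abs_nonneg y) k
  have h2 := Real.pow_div_factorial_le_exp |y| (abs_nonneg y) (k + 2)
  rw [div_le_iff₀ (by positivity)] at h1 h2
  rw [Real.norm_eq_abs, abs_of_nonneg (by positivity), Real.exp_neg, ← div_eq_mul_inv,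
    ← div_eq_mul_inv, div_le_div_iff₀ (Real.exp_pos _) (by positivity)]
  have : |y| ^ (k + 2) = |y| ^ k * y ^ 2 := by rw [pow_add, sq_abs]
  nlinarith

lemma HasConvexTail.integrable_exp_mul {p g : ℝ → ℝ} {x₀ c₁ c₂ : ℝ}
    (h : HasConvexTail p g x₀ c₁ c₂) (hp : IsProbDensity p) {t : ℝ} (ht : 0 ≤ t) :
    Integrable fun x => Real.exp (t * x) * p x := by
  obtain ⟨R, hR⟩ := eventually_atTop.1 (h.superlinear.eventually_ge_atTop (t + 1))
  set R' := max R x₀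
  have hi := (integrable_abs_pow_mul_exp_neg_abs 0).const_mul c₂
  have hm := hp.measurable
  refine ((hp.integrable.const_mul (Real.exp (t * R'))).add hi).mono' (by fun_prop)
    (ae_of_all _ fun x => ?_)
  rw [Real.norm_eq_abs, abs_of_nonneg (mul_nonneg (Real.exp_nonneg _) (hp.nonneg x))]
  have hc₂ := h.c₂_pos
  simp only [Pi.add_apply, pow_zero, one_mul]
  rcases le_total x R' with hx | hx
  · have h1 : Real.exp (t * x) * p x ≤ Real.exp (t * R') * p x := by
      have := hp.nonneg x
      gcongr
    have h2 : 0 ≤ c₂ * Real.exp (-|x|) := by positivity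
    linarith
  · have hx0 : x₀ ≤ x := (le_max_right _ _).trans hx
    have hxp : 0 < x := h.x₀_pos.trans_le hx0
    have h1 := hR x ((le_max_left _ _).trans hx)
    rw [le_div_iff₀ hxp] at h1
    have h2 : Real.exp (t * x) * p x ≤ c₂ * Real.exp (-|x|) := by
      calc _ ≤ Real.exp (t * x) * (c₂ * Real.exp (-g x)) := by gcongr; exact h.upper x hx0
        _ = c₂ * Real.exp (t * x - g x) := by rw [sub_eq_add_neg, Real.exp_add]; ring
        _ ≤ _ := by
          rw [abs_of_pos hxp]
          gcongr
          linarith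
    have h3 : 0 ≤ Real.exp (t * R') * p x := mul_nonneg (Real.exp_nonneg _) (hp.nonneg x)
    linarith

/-- The exponent of a tilted density: a convex function with minimum at `b` that grows at least
linearly away from `b`, on the scale `σ` of the interval where it stays within one of the
minimum. -/
lemma HasConvexTail.exists_scale {p g : ℝ → ℝ} {x₀ c₁ c₂ : ℝ} (h : HasConvexTail p g x₀ c₁ c₂)
    {t : ℝ} (ht : g (x₀ + 1) - g x₀ + 1 ≤ t) :
    ∃ b l r : ℝ, x₀ ≤ l ∧ l < b ∧ b < r ∧ 1 ≤ t * (b - l) ∧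
      (∀ x ∈ Icc l r, g x - t * x ≤ g b - t * b + 1) ∧
      ∀ x, x₀ ≤ x → g b - t * b + |x - b| / (r - l) - 1 ≤ g x - t * x := by
  set G : ℝ → ℝ := fun x => g x - t * x with hG
  have hGc : ContinuousOn G (Ici x₀) := h.continuousOn.sub (by fun_prop)
  have hGconv : ConvexOn ℝ (Ici x₀) G := by
    refine h.convexOn.sub ⟨convex_Ici _, fun x _ y _ a b _ _ _ => ?_⟩
    simp only [smul_eq_mul]
    exact le_of_eq (by ring)
  -- the lower bound on `t` makes `G` drop by one from `x₀` to `x₀ + 1`, so that it also takes the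
  -- value `min G + 1` to the left of its minimizer
  have h1 : G (x₀ + 1) ≤ G x₀ - 1 := by simp only [hG]; linarith
  obtain ⟨R, hR0, hR⟩ : ∃ R, x₀ + 1 ≤ R ∧ ∀ x, R ≤ x → G x₀ + 2 ≤ G x := by
    obtain ⟨R, hR⟩ := eventually_atTop.1 (h.superlinear.eventually_ge_atTop (t + |G x₀| + 2))
    refine ⟨max (max R 1) (x₀ + 1), le_max_right _ _, fun x hx => ?_⟩
    have hx1 : 1 ≤ x := (le_max_right R 1).trans ((le_max_left _ _).trans hx)
    have := hR x ((le_max_left R 1).trans ((le_max_left _ _).trans hx))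
    rw [le_div_iff₀ (by linarith)] at this
    simp only [hG] at this ⊢
    nlinarith [abs_nonneg (g x₀ - t * x₀), le_abs_self (g x₀ - t * x₀)]
  have hsub : Icc x₀ R ⊆ Ici x₀ := fun x hx => hx.1
  obtain ⟨b, hb, hbmin⟩ := isCompact_Icc.exists_isMinOn (s := Icc x₀ R) ⟨x₀, le_rfl, by linarith⟩
    (hGc.mono hsub)
  have hb1 : G b ≤ G (x₀ + 1) := hbmin ⟨by linarith, hR0⟩
  have hb0 : G b + 1 ≤ G x₀ := by linarith
  obtain ⟨l, hl, hGl⟩ := intermediate_value_Icc' hb.1 (hGc.mono fun x hx => hx.1)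
    (show G b + 1 ∈ Icc (G b) (G x₀) from ⟨by linarith, hb0⟩)
  obtain ⟨r, hr, hGr⟩ := intermediate_value_Icc hb.2 (hGc.mono fun x hx => hb.1.trans hx.1)
    (show G b + 1 ∈ Icc (G b) (G R) from ⟨by linarith, by linarith [hR R le_rfl]⟩)
  have hlb : l < b := lt_of_le_of_ne hl.2 (by rintro rfl; linarith)
  have hbr : b < r := lt_of_le_of_ne hr.1 (by rintro rfl; linarith)
  have hbm : b ∈ Ici x₀ := hb.1
  have hlm : l ∈ Ici x₀ := hl.1
  have hrm : r ∈ Ici x₀ := hb.1.trans hr.1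
  refine ⟨b, l, r, hl.1, hlb, hbr, ?_, fun x hx => ?_, fun x hx => ?_⟩
  -- `G` falls by one from `l` to `b` while `g` does not fall
  · have := h.monotoneOn hlm hbm hlb.le
    simp only [hG] at hGl
    linarith
  · have := hGconv.le_max_of_mem_Icc hlm hrm hx
    rwa [hGl, hGr, max_self] at this
  · change G b + |x - b| / (r - l) - 1 ≤ G x
    have hσ : 0 < r - l := by linarith
    rcases lt_or_ge x l with hxl | hxl
    · have hs := hGconv.secant_mono hbm hx hlm (by linarith) hlb.ne hxl.le
      rw [hGl, add_sub_cancel_left, div_le_iff_of_neg (by linarith),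
        div_mul_eq_mul_div, one_mul] at hs
      have h2 : |x - b| / (r - l) ≤ (x - b) / (l - b) := by
        rw [abs_of_neg (by linarith), ← neg_div_neg_eq (x - b) (l - b)]
        apply div_le_div_of_nonneg_left <;> linarith
      linarith
    · rcases le_or_gt x r with hxr | hxr
      · have hmin : G b ≤ G x := by
          exact hbmin ⟨hx, hxr.trans hr.2⟩
        have : |x - b| / (r - l) ≤ 1 := by
          rw [div_le_one hσ, abs_le]
          constructor <;> linarith
        linarith
      · have hs := hGconv.secant_mono hbm hrm hx hbr.ne' (by linarith) hxr.le
        rw [hGr, add_sub_cancel_left, le_div_iff₀ (by linarith), div_mul_eq_mul_div,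
          one_mul] at hs
        have h2 : |x - b| / (r - l) ≤ (x - b) / (r - b) := by
          rw [abs_of_pos (by linarith)]
          apply div_le_div_of_nonneg_left <;> linarith
        linarith

/-- The tilted densities have two-sided exponential envelopes, uniformly in the tilt up to
location and scale. -/
lemma HasConvexTail.exists_envelope {p g : ℝ → ℝ} {x₀ c₁ c₂ M : ℝ}
    (h : HasConvexTail p g x₀ c₁ c₂) (hp : IsProbDensity p) (hM : ∀ x, p x ≤ M) :
    ∃ K t₀ : ℝ, ∀ t, t₀ ≤ t → ∃ b σ : ℝ, 0 < σ ∧ ∀ x,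
      Real.exp (t * x) * p x ≤
        K / σ * Real.exp (-|x - b| / σ) * ∫ y, Real.exp (t * y) * p y := by
  have hc₁ := h.c₁_pos
  have hc₂ := h.c₂_pos
  have hM0 : 0 ≤ M := (hp.nonneg 0).trans (hM 0)
  -- the first term of the constant serves beyond `x₀`, the second one serves below `x₀`
  set C := c₂ * Real.exp 1 + M * Real.exp (g x₀ + 1) with hC
  refine ⟨C * Real.exp 1 / c₁, max 0 (g (x₀ + 1) - g x₀ + 1), fun t ht => ?_⟩
  have ht0 : 0 ≤ t := (le_max_left _ _).trans ht
  obtain ⟨b, l, r, hx₀l, hlb, hbr, htl, hin, hout⟩ := h.exists_scale ((le_max_right _ _).trans ht)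
  set σ := r - l with hσ
  have hσ0 : 0 < σ := by rw [hσ]; linarith
  have htσ : 1 / σ ≤ t := by
    rw [div_le_iff₀ hσ0]
    nlinarith
  set D := Real.exp (-(g b - t * b)) with hD
  -- the total mass is at least that of `[l, r]`
  have hmass : c₁ * (D * Real.exp (-1)) * σ ≤ ∫ y, Real.exp (t * y) * p y := by
    calc c₁ * (D * Real.exp (-1)) * σ = ∫ y in Icc l r, c₁ * (D * Real.exp (-1)) := by
          rw [setIntegral_const, smul_eq_mul, Measure.real, Real.volume_Icc,
            ENNReal.toReal_ofReal (by linarith)]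
          ring
      _ ≤ ∫ y in Icc l r, Real.exp (t * y) * p y := by
          refine setIntegral_mono_on (integrableOn_const (by simp))
            (h.integrable_exp_mul hp ht0).integrableOn measurableSet_Icc fun y hy => ?_
          calc c₁ * (D * Real.exp (-1)) = c₁ * Real.exp (-(g b - t * b + 1)) := by
                rw [hD, ← Real.exp_add]; ring_nf
            _ ≤ c₁ * Real.exp (-(g y - t * y)) := by
                have := hin y hy
                gcongr
            _ = Real.exp (t * y) * (c₁ * Real.exp (-g y)) := by
                rw [neg_sub, sub_eq_add_neg, Real.exp_add]; ring
            _ ≤ _ := by gcongr; exact h.lower y (hx₀l.trans hy.1)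
      _ ≤ _ := setIntegral_le_integral (h.integrable_exp_mul hp ht0)
          (ae_of_all _ fun y => mul_nonneg (Real.exp_nonneg _) (hp.nonneg y))
  refine ⟨b, σ, hσ0, fun x => ?_⟩
  have hkey : Real.exp (t * x) * p x ≤ C * (D * Real.exp (-|x - b| / σ)) := by
    have hE : 0 ≤ D * Real.exp (-|x - b| / σ) := by positivity
    rcases le_or_gt x₀ x with hx | hx
    · calc Real.exp (t * x) * p x ≤ Real.exp (t * x) * (c₂ * Real.exp (-g x)) := by
            gcongr; exact h.upper x hx
        _ = c₂ * Real.exp (-(g x - t * x)) := by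
            rw [neg_sub, sub_eq_add_neg, Real.exp_add]; ring
        _ ≤ c₂ * Real.exp (1 + (-(g b - t * b) + -|x - b| / σ)) := by
            have := hout x hx
            gcongr
            rw [neg_div]
            linarith
        _ = c₂ * Real.exp 1 * (D * Real.exp (-|x - b| / σ)) := by
            rw [Real.exp_add, Real.exp_add]; ring
        _ ≤ _ := by
            gcongr
            have : 0 ≤ M * Real.exp (g x₀ + 1) := by positivity
            linarith
    · have hxb : |x - b| = b - x := by rw [abs_of_neg (by linarith)]; ring
      have h0 := hout x₀ le_rfl
      rw [abs_of_neg (by linarith : x₀ - b < 0)] at h0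
      -- the envelope decays at rate `1 / σ ≤ t` to the left of `x₀`
      have h1 : t * x ≤ g x₀ + 1 + (-(g b - t * b) + -|x - b| / σ) := by
        rw [hxb]
        have h2 : 1 / σ * (x₀ - x) ≤ t * (x₀ - x) :=
          mul_le_mul_of_nonneg_right htσ (by linarith)
        have h3 : -(b - x) / σ = -(1 / σ * (x₀ - x)) - -(x₀ - b) / σ := by ring
        linarith
      calc Real.exp (t * x) * p x ≤
            Real.exp (g x₀ + 1 + (-(g b - t * b) + -|x - b| / σ)) * M := by
            have := hp.nonneg x
            gcongr
            exact hM x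
        _ = M * Real.exp (g x₀ + 1) * (D * Real.exp (-|x - b| / σ)) := by
            rw [Real.exp_add (g x₀ + 1), Real.exp_add (-(g b - t * b))]; ring
        _ ≤ _ := by
            gcongr
            have : 0 ≤ c₂ * Real.exp 1 := by positivity
            linarith
  have hC0 : 0 ≤ C := by positivity
  calc _ ≤ _ := hkey
    _ = C * Real.exp 1 / c₁ / σ * Real.exp (-|x - b| / σ) * (c₁ * (D * Real.exp (-1)) * σ) := by
        rw [Real.exp_neg 1]
        field_simp
    _ ≤ _ := by gcongr

/-! ### Normalization of densities with an exponential envelope -/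

lemma integrable_comp_affine {F : ℝ → ℝ} (hF : Integrable F) {s : ℝ} (hs : 0 < s) (m : ℝ) :
    Integrable fun x => F (m + s * x) :=
  (hF.comp_add_left m).comp_mul_left' hs.ne'

lemma integral_mul_comp_affine (F : ℝ → ℝ) {s : ℝ} (hs : 0 < s) (m : ℝ) :
    ∫ x, s * F (m + s * x) = ∫ x, F x := by
  rw [integral_const_mul, ← smul_eq_mul, integral_comp_affine F hs]

lemma IsProbDensity.affine {w : ℝ → ℝ} (hw : IsProbDensity w) {s : ℝ} (hs : 0 < s) (m : ℝ) :
    IsProbDensity fun x => s * w (m + s * x) :=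
  ⟨by have := hw.measurable; fun_prop, fun x => mul_nonneg hs.le (hw.nonneg _),
    (integrable_comp_affine hw.integrable hs m).const_mul s,
    by rw [integral_mul_comp_affine w hs, hw.integral_eq_one]⟩

section

variable {K : ℝ} {v : ℝ → ℝ}

lemma integrable_mul_abs_pow_of_envelope (hv : IsProbDensity v)
    (hK : ∀ y, v y ≤ K * Real.exp (-|y|)) (k : ℕ) : Integrable fun y => v y * |y| ^ k := by
  have hm := hv.measurable
  refine ((integrable_abs_pow_mul_exp_neg_abs k).const_mul K).mono' (by fun_prop)
    (ae_of_all _ fun y => ?_)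
  rw [Real.norm_eq_abs, abs_of_nonneg (mul_nonneg (hv.nonneg y) (by positivity))]
  have := mul_le_mul_of_nonneg_right (hK y) (pow_nonneg (abs_nonneg y) k)
  linarith

lemma integral_mul_abs_pow_le_of_envelope (hv : IsProbDensity v)
    (hK : ∀ y, v y ≤ K * Real.exp (-|y|)) (k : ℕ) :
    ∫ y, v y * |y| ^ k ≤ K * ∫ y : ℝ, |y| ^ k * Real.exp (-|y|) := by
  rw [← integral_const_mul]
  refine integral_mono (integrable_mul_abs_pow_of_envelope hv hK k)
    ((integrable_abs_pow_mul_exp_neg_abs k).const_mul K) fun y => ?_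
  have := mul_le_mul_of_nonneg_right (hK y) (pow_nonneg (abs_nonneg y) k)
  linarith

/-- A density bounded by `K` cannot have variance below `1 / (32 K²)`. -/
lemma variance_ge_of_le (hv : IsProbDensity v) (hK : ∀ y, v y ≤ K) (hK0 : 0 < K) (μ : ℝ)
    (hi : Integrable fun y => v y * (y - μ) ^ 2) :
    1 / (32 * K ^ 2) ≤ ∫ y, v y * (y - μ) ^ 2 := by
  set r : ℝ := 1 / (4 * K) with hr
  have hr0 : 0 < r := by positivity
  have hind : Integrable ((Icc (μ - r) (μ + r)).indicator fun _ : ℝ => K) :=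
    (integrableOn_const (by simp)).integrable_indicator measurableSet_Icc
  have h : ∫ y, r ^ 2 * (v y - (Icc (μ - r) (μ + r)).indicator (fun _ => K) y) ≤
      ∫ y, v y * (y - μ) ^ 2 := by
    refine integral_mono ((hv.integrable.sub hind).const_mul _) hi fun y => ?_
    have h0 := hv.nonneg y
    by_cases hy : y ∈ Icc (μ - r) (μ + r)
    · simp only [indicator_of_mem hy]
      have h1 : r ^ 2 * (v y - K) ≤ 0 :=
        mul_nonpos_of_nonneg_of_nonpos (by positivity) (by linarith [hK y])
      have h2 : 0 ≤ v y * (y - μ) ^ 2 := by positivity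
      linarith
    · simp only [indicator_of_notMem hy, sub_zero]
      have h1 : r ^ 2 ≤ (y - μ) ^ 2 := by
        rw [mem_Icc, not_and_or, not_le, not_le] at hy
        rcases hy with h | h <;> nlinarith
      nlinarith
  rw [integral_const_mul, integral_sub hv.integrable hind, hv.integral_eq_one,
    integral_indicator measurableSet_Icc, setIntegral_const, Measure.real, Real.volume_Icc,
    ENNReal.toReal_ofReal (by linarith), smul_eq_mul] at h
  have h2 : r ^ 2 * (1 - (μ + r - (μ - r)) * K) = 1 / (32 * K ^ 2) := by
    rw [hr]; field_simp; ring
  linarith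

end

/-- An envelope bounds the moments of the density from above, and its height bounds the variance
from below; so centring and scaling to variance one keeps the density in a fixed class. -/
lemma exists_isNormalizedDensity_of_unit_envelope (K : ℝ) :
    ∃ K' : ℝ, ∀ v, IsProbDensity v → (∀ y, v y ≤ K * Real.exp (-|y|)) →
      ∃ τ, 0 < τ ∧ IsNormalizedDensity K' fun z => τ * v ((∫ y, v y * y) + τ * z) := by
  set J : ℕ → ℝ := fun k => ∫ y : ℝ, |y| ^ k * Real.exp (-|y|) with hJ
  refine ⟨max (√(K * J 2) * K) (4 * (K * J 3 + (K * J 1) ^ 3) / √(1 / (32 * K ^ 2)) ^ 3),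
    fun v hv hK => ?_⟩
  have hK0 : 0 < K := by
    by_contra hK0
    have h0 : ∀ y, v y = 0 := fun y => le_antisymm ((hK y).trans
      (mul_nonpos_of_nonpos_of_nonneg (not_lt.1 hK0) (Real.exp_nonneg _))) (hv.nonneg y)
    have := hv.integral_eq_one
    simp [h0] at this
  have hvK : ∀ y, v y ≤ K := fun y => (hK y).trans (by
    have : Real.exp (-|y|) ≤ 1 := Real.exp_le_one_iff.2 (by linarith [abs_nonneg y])
    nlinarith)
  have hm := hv.measurable
  have hi : ∀ k, Integrable fun y => v y * |y| ^ k :=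
    integrable_mul_abs_pow_of_envelope hv hK
  have hle : ∀ k, ∫ y, v y * |y| ^ k ≤ K * J k := integral_mul_abs_pow_le_of_envelope hv hK
  have hi1 : Integrable fun y => v y * y := by
    refine (hi 1).mono (by fun_prop) (ae_of_all _ fun y => ?_)
    simp
  have hi2 : Integrable fun y => v y * y ^ 2 := by simpa [sq_abs] using hi 2
  set μ := ∫ y, v y * y with hμ
  have hμ1 : |μ| ≤ K * J 1 := by
    have h1 : ∀ y, ‖v y * y‖ = v y * |y| ^ 1 := fun y => by
      rw [norm_mul, Real.norm_eq_abs, abs_of_nonneg (hv.nonneg y), pow_one, Real.norm_eq_abs]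
    have h2 := norm_integral_le_integral_norm (μ := volume) fun y => v y * y
    simp only [h1] at h2
    exact h2.trans (hle 1)
  have hvi : Integrable fun y => v y * (y - μ) ^ 2 := by
    have := (hi2.sub (hi1.const_mul (2 * μ))).add (hv.integrable.mul_const (μ ^ 2))
    refine this.congr (ae_of_all _ fun y => ?_)
    simp only [Pi.add_apply, Pi.sub_apply]
    ring
  have hmean : ∫ y, v y * (y - μ) = 0 := by
    have : (fun y => v y * (y - μ)) = fun y => v y * y - v y * μ := by ext y; ring
    rw [this, integral_sub hi1 (hv.integrable.mul_const _), integral_mul_const,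
      hv.integral_eq_one, ← hμ, one_mul, sub_self]
  set S := ∫ y, v y * (y - μ) ^ 2 with hS
  have hSle : S ≤ K * J 2 := by
    have e : ∀ y, v y * (y - μ) ^ 2 = v y * |y| ^ 2 - (2 * μ) * (v y * (y - μ)) - v y * μ ^ 2 := by
      intro y; rw [sq_abs]; ring
    have hia : Integrable fun y => (2 * μ) * (v y * (y - μ)) := by
      refine ((hi1.sub (hv.integrable.mul_const μ)).const_mul (2 * μ)).congr
        (ae_of_all _ fun y => ?_)
      simp only [Pi.sub_apply]
      ring
    have hib : Integrable fun y => v y * |y| ^ 2 - (2 * μ) * (v y * (y - μ)) := (hi 2).sub hia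
    rw [hS]
    simp only [e]
    rw [integral_sub hib (hv.integrable.mul_const _), integral_sub (hi 2) hia,
      integral_const_mul, hmean, integral_mul_const, hv.integral_eq_one]
    have := hle 2
    nlinarith [sq_nonneg μ]
  have hSge : 1 / (32 * K ^ 2) ≤ S := variance_ge_of_le hv hvK hK0 μ hvi
  have hS0 : 0 < S := lt_of_lt_of_le (by positivity) hSge
  set τ := √S with hτ
  have hτ0 : 0 < τ := Real.sqrt_pos.2 hS0
  have hτ2 : τ ^ 2 = S := Real.sq_sqrt hS0.le
  have hdom3 : ∀ y, v y * |y - μ| ^ 3 ≤ 4 * (v y * |y| ^ 3 + v y * |μ| ^ 3) := by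
    intro y
    have h1 : |y - μ| ≤ |y| + |μ| := abs_sub _ _
    have h2 : |y - μ| ^ 3 ≤ 4 * (|y| ^ 3 + |μ| ^ 3) := by
      refine (pow_le_pow_left₀ (abs_nonneg _) h1 3).trans ?_
      have ha := abs_nonneg y
      have hb := abs_nonneg μ
      nlinarith [mul_nonneg (add_nonneg ha hb) (sq_nonneg (|y| - |μ|))]
    have := mul_le_mul_of_nonneg_left h2 (hv.nonneg y)
    linarith
  have hd3i : Integrable fun y => 4 * (v y * |y| ^ 3 + v y * |μ| ^ 3) :=
    ((hi 3).add (hv.integrable.mul_const _)).const_mul 4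
  have hi3 : Integrable fun y => v y * |y - μ| ^ 3 := by
    refine hd3i.mono' (by fun_prop) (ae_of_all _ fun y => ?_)
    rw [Real.norm_eq_abs, abs_of_nonneg (mul_nonneg (hv.nonneg y) (by positivity))]
    exact hdom3 y
  have h3le : ∫ y, v y * |y - μ| ^ 3 ≤ 4 * (K * J 3 + (K * J 1) ^ 3) := by
    refine (integral_mono hi3 hd3i hdom3).trans ?_
    rw [integral_const_mul, integral_add (hi 3) (hv.integrable.mul_const _), integral_mul_const,
      hv.integral_eq_one, one_mul]
    have := pow_le_pow_left₀ (abs_nonneg μ) hμ1 3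
    linarith [hle 3]
  have hcancel : ∀ z : ℝ, (μ + τ * z - μ) / τ = z := fun z => by field_simp; ring
  have hfun3 : (fun z => τ * v (μ + τ * z) * |z| ^ 3) =
      fun z => τ * (fun y => (v y * |y - μ| ^ 3) / τ ^ 3) (μ + τ * z) := by
    ext z
    have : |z| = |μ + τ * z - μ| / τ := by
      rw [add_sub_cancel_left, abs_mul, abs_of_pos hτ0, mul_div_cancel_left₀ _ hτ0.ne']
    simp only
    rw [this]
    ring
  refine ⟨τ, hτ0, ⟨hv.affine hτ0 μ, fun z => ?_, ?_, ?_, ?_, ?_⟩⟩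
  · refine le_trans ?_ (le_max_left _ _)
    exact mul_le_mul (Real.sqrt_le_sqrt hSle) (hvK _) (hv.nonneg _) (Real.sqrt_nonneg _)
  · rw [hfun3]
    exact (integrable_comp_affine (hi3.div_const _) hτ0 μ).const_mul τ
  · have : (fun z => τ * v (μ + τ * z) * z) =
        fun z => τ * (fun y => (v y * (y - μ)) / τ) (μ + τ * z) := by
      ext z
      conv_lhs => rw [← hcancel z]
      simp only [hcancel]
      rw [mul_div_assoc, hcancel]
      ring
    rw [this, integral_mul_comp_affine (fun y => (v y * (y - μ)) / τ) hτ0, integral_div,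
      hmean, zero_div]
  · have : (fun z => τ * v (μ + τ * z) * z ^ 2) =
        fun z => τ * (fun y => (v y * (y - μ) ^ 2) / τ ^ 2) (μ + τ * z) := by
      ext z
      simp only
      rw [mul_div_assoc, ← div_pow, hcancel]
      ring
    rw [this, integral_mul_comp_affine (fun y => (v y * (y - μ) ^ 2) / τ ^ 2) hτ0, integral_div,
      hτ2, div_self hS0.ne']
  · refine le_trans ?_ (le_max_right _ _)
    rw [hfun3, integral_mul_comp_affine (fun y => (v y * |y - μ| ^ 3) / τ ^ 3) hτ0, integral_div]
    have h0 : 0 < √(1 / (32 * K ^ 2)) := Real.sqrt_pos.2 (by positivity)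
    have h1 : √(1 / (32 * K ^ 2)) ≤ τ := Real.sqrt_le_sqrt hSge
    have h2 : 0 ≤ ∫ y, v y * |y - μ| ^ 3 :=
      integral_nonneg fun y => mul_nonneg (hv.nonneg y) (by positivity)
    exact div_le_div₀ (h2.trans h3le) h3le (by positivity) (by gcongr)

/-- A density with a two-sided exponential envelope at location `b` and scale `σ` is, once centred
and normalized, in a class depending only on the constant `K` of the envelope. -/
lemma exists_isNormalizedDensity_of_envelope (K : ℝ) :
    ∃ K' : ℝ, ∀ (w : ℝ → ℝ) (b σ : ℝ), IsProbDensity w → 0 < σ →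
      (∀ x, w x ≤ K / σ * Real.exp (-|x - b| / σ)) →
      ∃ s, 0 < s ∧ IsNormalizedDensity K' fun z => s * w ((∫ x, w x * x) + s * z) := by
  obtain ⟨K', hK'⟩ := exists_isNormalizedDensity_of_unit_envelope K
  refine ⟨K', fun w b σ hw hσ hle => ?_⟩
  have hv := hw.affine hσ b
  have henv : ∀ y, σ * w (b + σ * y) ≤ K * Real.exp (-|y|) := by
    intro y
    have h := mul_le_mul_of_nonneg_left (hle (b + σ * y)) hσ.le
    rw [add_sub_cancel_left, abs_mul, abs_of_pos hσ] at h
    refine h.trans (le_of_eq ?_)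
    have : -(σ * |y|) / σ = -|y| := by field_simp
    rw [this]
    field_simp
  obtain ⟨τ, hτ, hn⟩ := hK' _ hv henv
  have hi : Integrable fun y => σ * w (b + σ * y) * y := by
    have hm := hv.measurable
    refine (integrable_mul_abs_pow_of_envelope hv henv 1).mono (by fun_prop)
      (ae_of_all _ fun y => ?_)
    simp
  have hmean : ∫ x, w x * x = b + σ * ∫ y, σ * w (b + σ * y) * y := by
    rw [← integral_mul_comp_affine (fun x => w x * x) hσ b, ← integral_const_mul]
    have : ∀ y, σ * (w (b + σ * y) * (b + σ * y)) =
        (σ * w (b + σ * y)) * b + σ * (σ * w (b + σ * y) * y) := fun y => by ring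
    simp only [this]
    rw [integral_add (hv.integrable.mul_const b) (hi.const_mul σ), integral_mul_const,
      hv.integral_eq_one, one_mul]
  refine ⟨σ * τ, by positivity, ?_⟩
  convert hn using 2 with z
  rw [hmean]
  have : b + σ * (∫ y, σ * w (b + σ * y) * y) + σ * τ * z =
      b + σ * ((∫ y, σ * w (b + σ * y) * y) + τ * z) := by ring
  rw [this]
  ring

/-! ### The tilting parameter -/

section

variable {Ω : Type*} [MeasurableSpace Ω] {P : Measure Ω} {Z : Ω → ℝ} {w : ℝ → ℝ}

lemma integral_comp_eq_of_map_eq {E : Type*} [NormedAddCommGroup E] [NormedSpace ℝ E]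
    (hZ : Measurable Z) (hlaw : P.map Z = densMeasure w) (hw : IsProbDensity w) {F : ℝ → E}
    (hF : StronglyMeasurable F) : ∫ ω, F (Z ω) ∂P = ∫ x, w x • F x := by
  rw [← integral_densMeasure hw.measurable hw.nonneg, ← hlaw,
    integral_map hZ.aemeasurable hF.aestronglyMeasurable]

lemma mgf_eq_integral (hZ : Measurable Z) (hlaw : P.map Z = densMeasure w)
    (hw : IsProbDensity w) (t : ℝ) : mgf Z P t = ∫ x, Real.exp (t * x) * w x := by
  rw [mgf, integral_comp_eq_of_map_eq hZ hlaw hw (F := fun x => Real.exp (t * x))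
    (by fun_prop)]
  simp only [smul_eq_mul, mul_comm]

lemma deriv_cgf_eq_integral (hZ : Measurable Z) (hlaw : P.map Z = densMeasure w)
    (hw : IsProbDensity w) {t : ℝ} (ht : t ∈ interior (integrableExpSet Z P)) :
    deriv (cgf Z P) t = ∫ x, Real.exp (t * x) / mgf Z P t * w x * x := by
  rw [deriv_cgf ht, integral_comp_eq_of_map_eq hZ hlaw hw (F := fun x => x * Real.exp (t * x))
    (by fun_prop), ← integral_div]
  congr 1; ext x
  rw [smul_eq_mul]; ring

lemma isTiltParam_tiltParam {a : ℝ} (h : ∃! t, IsTiltParam P Z a t) :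
    IsTiltParam P Z a (tiltParam P Z a) := by
  obtain ⟨t, ht, huniq⟩ := h
  have : {t : ℝ | IsTiltParam P Z a t} = {t} := by
    ext u
    exact ⟨fun hu => huniq u hu, fun hu => by rw [mem_singleton_iff.1 hu]; exact ht⟩
  rw [tiltParam, this, csInf_singleton]
  exact ht

variable {g : ℝ → ℝ} {x₀ c₁ c₂ : ℝ}

/-- The density has exponential moments of every positive order, as `g` is superlinear. -/
lemma HasConvexTail.mem_interior (htail : HasConvexTail w g x₀ c₁ c₂) (hZ : Measurable Z)
    (hlaw : P.map Z = densMeasure w) (hw : IsProbDensity w)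
    (h0 : (0 : ℝ) ∈ interior (integrableExpSet Z P)) {t : ℝ} (ht : 0 ≤ t) :
    t ∈ interior (integrableExpSet Z P) := by
  rcases ht.eq_or_lt with rfl | ht
  · exact h0
  · refine _root_.mem_interior.2 ⟨Ioi 0, fun u hu => ?_, isOpen_Ioi, ht⟩
    have h1 : Integrable (fun x => Real.exp (u * x)) (P.map Z) := by
      rw [hlaw, integrable_densMeasure_iff hw.measurable hw.nonneg]
      simpa only [mul_comm] using htail.integrable_exp_mul hw (le_of_lt hu)
    exact h1.comp_measurable hZ

variable [IsProbabilityMeasure P]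

lemma iteratedDeriv_two_cgf_pos (hZ : Measurable Z) (hlaw : P.map Z = densMeasure w) {t : ℝ}
    (ht : t ∈ interior (integrableExpSet Z P)) : 0 < iteratedDeriv 2 (cgf Z P) t := by
  rw [iteratedDeriv_two_cgf_eq_integral ht]
  set m := deriv (cgf Z P) t
  refine div_pos ?_ (mgf_pos (interior_subset ht : t ∈ integrableExpSet Z P))
  have hnn : ∀ ω, 0 ≤ (Z ω - m) ^ 2 * Real.exp (t * Z ω) := fun ω => by positivity
  have hint : Integrable (fun ω => (Z ω - m) ^ 2 * Real.exp (t * Z ω)) P := by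
    have h := fun n => integrable_pow_mul_exp_of_mem_interior_integrableExpSet ht n
    refine (((h 2).sub ((h 1).const_mul (2 * m))).add ((h 0).const_mul (m ^ 2))).congr
      (ae_of_all _ fun ω => ?_)
    simp only [Pi.add_apply, Pi.sub_apply]
    ring
  refine lt_of_le_of_ne (integral_nonneg hnn) fun h0 => ?_
  have hae := (integral_eq_zero_iff_of_nonneg hnn hint).1 h0.symm
  -- a law with a density has no atoms
  have hatom : P (Z ⁻¹' {m}) = 0 := by
    rw [← Measure.map_apply hZ (measurableSet_singleton m), hlaw]
    exact withDensity_absolutelyContinuous _ _ Real.volume_singleton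
  have hone : P (Z ⁻¹' {m})ᶜ = 0 := by
    refine measure_mono_null (fun ω hω => ?_) hae
    have : Z ω - m ≠ 0 := sub_ne_zero.2 hω
    simp only [mem_compl_iff, mem_ofPred_eq, Pi.zero_apply]
    positivity
  have hu : P Set.univ = 0 := by
    rw [← union_compl_self (Z ⁻¹' {m})]
    exact measure_union_null hatom hone
  simp at hu

lemma strictMonoOn_deriv_cgf (hZ : Measurable Z) (hlaw : P.map Z = densMeasure w) :
    StrictMonoOn (deriv (cgf Z P)) (interior (integrableExpSet Z P)) := by
  refine strictMonoOn_of_deriv_pos convex_integrableExpSet.interior ?_ fun t ht => ?_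
  · exact analyticOnNhd_cgf.deriv.continuousOn
  · have h := iteratedDeriv_two_cgf_pos hZ hlaw (interior_subset ht)
    rwa [iteratedDeriv_succ, iteratedDeriv_one] at h

/-- The mean of the tilted law is unbounded: the law of `Z` charges every neighbourhood of
infinity. -/
lemma HasConvexTail.exists_lt_deriv_cgf (htail : HasConvexTail w g x₀ c₁ c₂) (hZ : Measurable Z)
    (hlaw : P.map Z = densMeasure w) (hw : IsProbDensity w)
    (h0 : (0 : ℝ) ∈ interior (integrableExpSet Z P)) (B : ℝ) :
    ∃ t, 0 ≤ t ∧ B < deriv (cgf Z P) t := by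
  by_contra! hB
  have hmem : ∀ t, 0 ≤ t → t ∈ interior (integrableExpSet Z P) := fun t ht =>
    htail.mem_interior hZ hlaw hw h0 ht
  -- a mean bounded by `B` would give `mgf t ≤ exp (B t)`, but beyond `B + 1` there is mass
  set a := max (B + 1) x₀
  have hcgf : ∀ t, 0 ≤ t → cgf Z P t ≤ B * t := by
    intro t ht
    have h2 := Convex.image_sub_le_mul_sub_of_deriv_le (convex_Ici (0 : ℝ)) (f := cgf Z P) (C := B)
      (fun x hx => (analyticAt_cgf (hmem x hx)).continuousAt.continuousWithinAt)
      (fun x hx =>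
        (analyticAt_cgf (hmem x (interior_subset hx))).differentiableAt.differentiableWithinAt)
      (fun x hx => hB x (interior_subset hx)) 0 self_mem_Ici t ht ht
    simpa using h2
  set c := ∫ x in Icc a (a + 1), w x with hc
  have hcpos : 0 < c := by
    have hcont : ContinuousOn (fun x => c₁ * Real.exp (-g x)) (Icc a (a + 1)) :=
      continuousOn_const.mul (Real.continuous_exp.comp_continuousOn
        ((htail.continuousOn.mono fun x hx => (le_max_right _ _).trans hx.1).neg))
    have h1 : 0 < ∫ x in Icc a (a + 1), c₁ * Real.exp (-g x) := by
      rw [setIntegral_pos_iff_support_of_nonneg_ae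
        (ae_of_all _ fun x => mul_nonneg htail.c₁_pos.le (Real.exp_nonneg _))
        (hcont.integrableOn_compact isCompact_Icc)]
      have : Function.support (fun x => c₁ * Real.exp (-g x)) = Set.univ := by
        ext x
        simp [htail.c₁_pos.ne']
      rw [this, univ_inter, Real.volume_Icc]
      simp
    refine h1.trans_le (setIntegral_mono_on (hcont.integrableOn_compact isCompact_Icc)
      hw.integrable.integrableOn measurableSet_Icc fun x hx =>
        htail.lower x ((le_max_right _ _).trans hx.1))
  have hmgf : ∀ t, 0 ≤ t → Real.exp (t * a) * c ≤ Real.exp (B * t) := by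
    intro t ht
    have hi := htail.integrable_exp_mul hw ht
    calc Real.exp (t * a) * c = ∫ x in Icc a (a + 1), Real.exp (t * a) * w x := by
          rw [integral_const_mul]
      _ ≤ ∫ x in Icc a (a + 1), Real.exp (t * x) * w x := by
          refine setIntegral_mono_on (hw.integrable.const_mul _).integrableOn hi.integrableOn
            measurableSet_Icc fun x hx => ?_
          have := hw.nonneg x
          have := hx.1
          gcongr
      _ ≤ ∫ x, Real.exp (t * x) * w x := setIntegral_le_integral hi
          (ae_of_all _ fun x => mul_nonneg (Real.exp_nonneg _) (hw.nonneg x))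
      _ = Real.exp (cgf Z P t) := by
          rw [← mgf_eq_integral hZ hlaw hw, exp_cgf (interior_subset (hmem t ht) :
            t ∈ integrableExpSet Z P)]
      _ ≤ _ := Real.exp_le_exp.2 (hcgf t ht)
  have hlim : Tendsto (fun t : ℝ => Real.exp t * c) atTop atTop :=
    Real.tendsto_exp_atTop.atTop_mul_const hcpos
  obtain ⟨t, ht1, ht0⟩ := ((hlim.eventually_gt_atTop 1).and (eventually_ge_atTop 0)).exists
  have h1 := hmgf t ht0
  have h2 : Real.exp (B * t) * Real.exp t ≤ Real.exp (t * a) := by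
    rw [← Real.exp_add, Real.exp_le_exp]
    have : B + 1 ≤ a := le_max_left _ _
    nlinarith
  have h3 : Real.exp (B * t) * (Real.exp t * c) ≤ Real.exp (B * t) * 1 := by
    rw [← mul_assoc, mul_one]
    exact (mul_le_mul_of_nonneg_right h2 hcpos.le).trans h1
  exact absurd (le_of_mul_le_mul_left h3 (Real.exp_pos _)) (not_le.2 ht1)

lemma HasConvexTail.existsUnique_isTiltParam (htail : HasConvexTail w g x₀ c₁ c₂)
    (hZ : Measurable Z) (hlaw : P.map Z = densMeasure w) (hw : IsProbDensity w)
    (h0 : (0 : ℝ) ∈ interior (integrableExpSet Z P)) {a : ℝ} (ha : deriv (cgf Z P) 0 ≤ a) :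
    ∃! t, IsTiltParam P Z a t := by
  obtain ⟨T, hT0, hT⟩ := htail.exists_lt_deriv_cgf hZ hlaw hw h0 a
  have hcont : ContinuousOn (deriv (cgf Z P)) (Icc 0 T) :=
    analyticOnNhd_cgf.deriv.continuousOn.mono fun t ht =>
      htail.mem_interior hZ hlaw hw h0 ht.1
  obtain ⟨t, ht, hta⟩ := intermediate_value_Icc hT0 hcont ⟨ha, hT.le⟩
  refine ⟨t, ⟨htail.mem_interior hZ hlaw hw h0 ht.1, hta⟩, fun t' ht' => ?_⟩
  exact (strictMonoOn_deriv_cgf hZ hlaw).injOn ht'.1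
    (htail.mem_interior hZ hlaw hw h0 ht.1) (ht'.2.trans hta.symm)

lemma HasConvexTail.tendsto_tiltParam (htail : HasConvexTail w g x₀ c₁ c₂)
    (hZ : Measurable Z) (hlaw : P.map Z = densMeasure w) (hw : IsProbDensity w)
    (h0 : (0 : ℝ) ∈ interior (integrableExpSet Z P)) :
    Tendsto (tiltParam P Z) atTop atTop := by
  refine tendsto_atTop.2 fun T => ?_
  have hmem := htail.mem_interior hZ hlaw hw h0 (le_max_right T 0)
  filter_upwards [eventually_ge_atTop (deriv (cgf Z P) 0),
    eventually_gt_atTop (deriv (cgf Z P) (max T 0))] with a ha1 ha2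
  have h := isTiltParam_tiltParam (htail.existsUnique_isTiltParam hZ hlaw hw h0 ha1)
  refine (le_max_left T 0).trans (le_of_lt ?_)
  rw [← (strictMonoOn_deriv_cgf hZ hlaw).lt_iff_lt hmem h.1, h.2]
  exact ha2

end

/-! ### Conditional laws given a point event -/

/-- The mean of `W` over the interval of radius `r` about `y`. -/
noncomputable def ballMean (W : ℝ → ℝ) (r y : ℝ) : ℝ := (2 * r)⁻¹ * ∫ s in (y - r)..(y + r), W s

section

variable {W : ℝ → ℝ} {M : ℝ}

lemma continuous_ballMean (hW : Continuous W) (r : ℝ) : Continuous (ballMean W r) := by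
  have h : ∀ y, ballMean W r y =
      (2 * r)⁻¹ * ((∫ s in (0 : ℝ)..(y + r), W s) - ∫ s in (0 : ℝ)..(y - r), W s) := by
    intro y
    rw [ballMean, intervalIntegral.integral_interval_sub_left (hW.intervalIntegrable _ _)
      (hW.intervalIntegrable _ _)]
  have hc := intervalIntegral.continuous_primitive (μ := volume)
    (fun a b => hW.intervalIntegrable a b) 0
  have h2 : ballMean W r = fun y =>
      (2 * r)⁻¹ * ((∫ s in (0 : ℝ)..(y + r), W s) - ∫ s in (0 : ℝ)..(y - r), W s) := funext h
  rw [h2]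
  exact continuous_const.mul ((hc.comp (by fun_prop)).sub (hc.comp (by fun_prop)))

lemma ballMean_nonneg (h0 : ∀ x, 0 ≤ W x) {r : ℝ} (hr : 0 < r) (y : ℝ) : 0 ≤ ballMean W r y :=
  mul_nonneg (by positivity) (intervalIntegral.integral_nonneg (by linarith) fun s _ => h0 s)

lemma abs_ballMean_sub_le (hW : Continuous W) {r y c η : ℝ} (hr : 0 < r)
    (h : ∀ s, |s - y| ≤ r → |W s - c| ≤ η) : |ballMean W r y - c| ≤ η := by
  have h1 : ballMean W r y - c = (2 * r)⁻¹ * ∫ s in (y - r)..(y + r), (W s - c) := by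
    rw [intervalIntegral.integral_sub (hW.intervalIntegrable _ _) (by simp), ballMean,
      intervalIntegral.integral_const, smul_eq_mul]
    field_simp
    ring
  have h2 := intervalIntegral.norm_integral_le_of_norm_le_const (a := y - r) (b := y + r)
    (f := fun s => W s - c) (C := η) fun s hs => by
      rw [uIoc_of_le (by linarith)] at hs
      exact h s (abs_le.2 ⟨by linarith [hs.1], by linarith [hs.2]⟩)
  rw [h1, abs_mul, abs_of_pos (by positivity), inv_mul_le_iff₀ (by positivity)]
  calc _ ≤ _ := h2
    _ = _ := by rw [abs_of_pos (by linarith)]; ring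

lemma abs_ballMean_le (hW : Continuous W) (hM : ∀ x, |W x| ≤ M) {r : ℝ} (hr : 0 < r) (y : ℝ) :
    |ballMean W r y| ≤ M := by
  simpa using abs_ballMean_sub_le (c := 0) hW hr fun s _ => by simpa using hM s

lemma tendsto_ballMean (hW : Continuous W) (y : ℝ) :
    Tendsto (fun r => ballMean W r y) (𝓝[>] 0) (𝓝 (W y)) := by
  rw [Metric.tendsto_nhds]
  intro η hη
  obtain ⟨δ, hδ, h⟩ := Metric.continuousAt_iff.1 (hW.continuousAt (x := y)) (η / 2) (half_pos hη)
  filter_upwards [Ioo_mem_nhdsGT hδ] with r hr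
  rw [Real.dist_eq]
  refine (abs_ballMean_sub_le hW hr.1 fun s hs => ?_).trans_lt (half_lt_self hη)
  exact (h (by rw [Real.dist_eq]; exact hs.trans_lt hr.2)).le

lemma densMeasure_ball (hW : Continuous W) (h0 : ∀ x, 0 ≤ W x) {r : ℝ} (hr : 0 < r) (y : ℝ) :
    densMeasure W {s | |s - y| < r} = ENNReal.ofReal (2 * r) * ENNReal.ofReal (ballMean W r y) := by
  have hset : {s | |s - y| < r} = Ioo (y - r) (y + r) := by
    ext s
    simp only [mem_ofPred_eq, mem_Ioo, abs_lt]
    constructor <;> rintro ⟨h1, h2⟩ <;> constructor <;> linarith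
  rw [hset, densMeasure, withDensity_apply _ measurableSet_Ioo, ← ENNReal.ofReal_mul (by linarith),
    ← ofReal_integral_eq_lintegral_ofReal
    ((hW.integrableOn_Icc).mono_set Ioo_subset_Icc_self) (ae_of_all _ h0), ballMean,
    intervalIntegral.integral_of_le (by linarith), integral_Ioc_eq_integral_Ioo]
  congr 1
  field_simp

end

section

variable {Ω F : Type*} [MeasurableSpace Ω] [MeasurableSpace F] {P : Measure Ω}
  [IsProbabilityMeasure P] {Y : Ω → F} {T : Ω → ℝ} {f : F → ℝ} {W : ℝ → ℝ} {M v : ℝ}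

/-- By Fubini, an event on `Y` together with `|f(Y) + T - v| < r` has probability `2 r` times the
integral over the event of a local mean of the density of `T`. -/
lemma measure_inter_ball (hY : Measurable Y) (hT : Measurable T) (hf : Measurable f)
    (hind : IndepFun Y T P) (hlaw : P.map T = densMeasure W) (hW : Continuous W)
    (h0 : ∀ x, 0 ≤ W x) (hM : ∀ x, W x ≤ M) {r : ℝ} (hr : 0 < r) {B : Set F}
    (hB : MeasurableSet B) :
    P ({ω | |f (Y ω) + T ω - v| < r} ∩ Y ⁻¹' B) =
      ENNReal.ofReal (2 * r) * ENNReal.ofReal (∫ y in B, ballMean W r (v - f y) ∂(P.map Y)) := by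
  have hPY : IsProbabilityMeasure (P.map Y) := Measure.isProbabilityMeasure_map hY.aemeasurable
  have hPT : IsProbabilityMeasure (P.map T) := Measure.isProbabilityMeasure_map hT.aemeasurable
  have hbm := (continuous_ballMean hW r).measurable
  have hSmeas : MeasurableSet {z : F × ℝ | |f z.1 + z.2 - v| < r ∧ z.1 ∈ B} :=
    (measurableSet_lt (f := fun z : F × ℝ => |f z.1 + z.2 - v|) (by fun_prop)
      measurable_const).inter (measurable_fst hB)
  have h1 : P ({ω | |f (Y ω) + T ω - v| < r} ∩ Y ⁻¹' B) =
      ((P.map Y).prod (P.map T)) {z : F × ℝ | |f z.1 + z.2 - v| < r ∧ z.1 ∈ B} := by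
    rw [← (indepFun_iff_map_prod_eq_prod_map_map hY.aemeasurable hT.aemeasurable).1 hind,
      Measure.map_apply (hY.prodMk hT) hSmeas]
    rfl
  rw [h1, Measure.prod_apply hSmeas]
  have h2 : ∀ y, (P.map T) (Prod.mk y ⁻¹' {z : F × ℝ | |f z.1 + z.2 - v| < r ∧ z.1 ∈ B}) =
      B.indicator
        (fun y => ENNReal.ofReal (2 * r) * ENNReal.ofReal (ballMean W r (v - f y))) y := by
    intro y
    by_cases hy : y ∈ B
    · rw [indicator_of_mem hy, hlaw, ← densMeasure_ball hW h0 hr]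
      congr 1
      ext s
      simp only [mem_preimage, mem_ofPred_eq, hy, and_true]
      rw [show f y + s - v = s - (v - f y) by ring]
    · rw [indicator_of_notMem hy]
      have : (Prod.mk y ⁻¹' {z : F × ℝ | |f z.1 + z.2 - v| < r ∧ z.1 ∈ B}) = ∅ := by
        ext s; simp [hy]
      rw [this, measure_empty]
  simp only [h2]
  rw [lintegral_indicator hB, lintegral_const_mul _ (by fun_prop),
    ofReal_integral_eq_lintegral_ofReal]
  · refine Integrable.integrableOn (Integrable.of_bound (C := M)
      (hbm.comp (measurable_const.sub hf)).aestronglyMeasurable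
      (ae_of_all _ fun y => abs_ballMean_le hW (fun x => ?_) hr _))
    rw [abs_of_nonneg (h0 x)]; exact hM x
  · exact ae_of_all _ fun y => ballMean_nonneg h0 hr _

/-- If `T` is independent of `Y` and has a bounded continuous density `W`, then the conditional law
of `Y` given `f(Y) + T = v` has density proportional to `W (v - f y)` relative to the law
of `Y`. -/
theorem isCondLawAt_of_density (hY : Measurable Y) (hT : Measurable T) (hf : Measurable f)
    (hind : IndepFun Y T P) (hlaw : P.map T = densMeasure W) (hW : Continuous W)
    (h0 : ∀ x, 0 ≤ W x) (hM : ∀ x, W x ≤ M) (hD : 0 < ∫ y, W (v - f y) ∂(P.map Y)) :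
    IsCondLawAt P Y (fun ω => f (Y ω) + T ω) v
      ((P.map Y).withDensity fun y =>
        ENNReal.ofReal (W (v - f y) / ∫ y, W (v - f y) ∂(P.map Y))) := by
  have hPY : IsProbabilityMeasure (P.map Y) := Measure.isProbabilityMeasure_map hY.aemeasurable
  set D := ∫ y, W (v - f y) ∂(P.map Y) with hDdef
  have hWm := hW.measurable
  have habs : ∀ x, |W x| ≤ M := fun x => by rw [abs_of_nonneg (h0 x)]; exact hM x
  have hint : Integrable (fun y => W (v - f y)) (P.map Y) :=
    Integrable.of_bound (C := M) (by fun_prop) (ae_of_all _ fun y => habs _)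
  have hlim : ∀ B : Set F, Tendsto (fun r => ∫ y in B, ballMean W r (v - f y) ∂(P.map Y)) (𝓝[>] 0)
      (𝓝 (∫ y in B, W (v - f y) ∂(P.map Y))) := by
    intro B
    refine tendsto_integral_filter_of_dominated_convergence (fun _ => M) ?_ ?_
      (integrable_const _) (ae_of_all _ fun y => tendsto_ballMean hW _)
    · refine Eventually.of_forall fun r => ?_
      exact ((continuous_ballMean hW r).measurable.comp
        (measurable_const.sub hf)).aestronglyMeasurable
    · filter_upwards [self_mem_nhdsWithin] with r hr
      exact ae_of_all _ fun y => abs_ballMean_le hW habs hr _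
  have hval : ∀ B : Set F, MeasurableSet B →
      ((P.map Y).withDensity fun y => ENNReal.ofReal (W (v - f y) / D)) B =
        (ENNReal.ofReal D)⁻¹ * ENNReal.ofReal (∫ y in B, W (v - f y) ∂(P.map Y)) := by
    intro B hB
    rw [withDensity_apply _ hB,
      ← ofReal_integral_eq_lintegral_ofReal (hint.div_const D).integrableOn
      (ae_of_all _ fun y => div_nonneg (h0 _) hD.le), integral_div, ENNReal.ofReal_div_of_pos hD,
      div_eq_mul_inv, mul_comm]
  have hDtop : (ENNReal.ofReal D)⁻¹ ≠ ∞ := ENNReal.inv_ne_top.2 (ENNReal.ofReal_pos.2 hD).ne'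
  refine ⟨⟨?_⟩, fun B hB => ?_⟩
  · rw [hval _ MeasurableSet.univ, setIntegral_univ, ← hDdef]
    exact ENNReal.inv_mul_cancel (ENNReal.ofReal_pos.2 hD).ne' ENNReal.ofReal_ne_top
  · rw [hval B hB]
    have h1 : Tendsto (fun r => ENNReal.ofReal (∫ y, ballMean W r (v - f y) ∂(P.map Y))) (𝓝[>] 0)
        (𝓝 (ENNReal.ofReal D)) := by
      have := ENNReal.tendsto_ofReal (hlim Set.univ)
      simpa only [setIntegral_univ] using this
    have h2 := ENNReal.Tendsto.mul (tendsto_inv_iff.2 h1)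
      (Or.inr ENNReal.ofReal_ne_top) (ENNReal.tendsto_ofReal (hlim B)) (Or.inr hDtop)
    refine h2.congr' ?_
    filter_upwards [self_mem_nhdsWithin] with r hr
    have hr0 : (0 : ℝ) < r := hr
    have hms : MeasurableSet {ω | |f (Y ω) + T ω - v| < r} :=
      measurableSet_lt (by fun_prop) measurable_const
    have h3 := measure_inter_ball hY hT hf hind hlaw hW h0 hM hr0 (v := v) MeasurableSet.univ
    rw [preimage_univ, inter_univ, setIntegral_univ] at h3
    rw [cond_apply hms, measure_inter_ball hY hT hf hind hlaw hW h0 hM hr0 hB, h3,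
      ENNReal.mul_inv (Or.inr ENNReal.ofReal_ne_top) (Or.inl ENNReal.ofReal_ne_top)]
    have h4 : (ENNReal.ofReal (2 * r))⁻¹ * ENNReal.ofReal (2 * r) = 1 :=
      ENNReal.inv_mul_cancel (ENNReal.ofReal_pos.2 (by linarith)).ne' ENNReal.ofReal_ne_top
    calc _ = ((ENNReal.ofReal (2 * r))⁻¹ * ENNReal.ofReal (2 * r)) *
          ((ENNReal.ofReal (∫ y, ballMean W r (v - f y) ∂(P.map Y)))⁻¹ *
          ENNReal.ofReal (∫ y in B, ballMean W r (v - f y) ∂(P.map Y))) := by rw [h4, one_mul]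
      _ = _ := by ring

end

/-- The variation distance of two measures with densities is at most the `L¹` distance of the
densities. -/
lemma variationDist_withDensity_le {F : Type*} [MeasurableSpace F] {L : Measure F} {a b : F → ℝ}
    (ha : Integrable a L) (hb : Integrable b L) (ha0 : ∀ x, 0 ≤ a x) (hb0 : ∀ x, 0 ≤ b x) :
    variationDist (L.withDensity fun x => ENNReal.ofReal (a x))
      (L.withDensity fun x => ENNReal.ofReal (b x)) ≤ ∫ x, |a x - b x| ∂L := by
  have hreal : ∀ {c : F → ℝ}, Integrable c L → (∀ x, 0 ≤ c x) → ∀ B : Set F, MeasurableSet B →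
      (L.withDensity fun x => ENNReal.ofReal (c x)).real B = ∫ x in B, c x ∂L := by
    intro c hc hc0 B hB
    rw [Measure.real, withDensity_apply _ hB,
      integral_eq_lintegral_of_nonneg_ae (ae_of_all _ hc0) hc.integrableOn.1]
  have : Nonempty {B : Set F // MeasurableSet B} := ⟨⟨∅, MeasurableSet.empty⟩⟩
  refine ciSup_le fun B => ?_
  rw [hreal ha ha0 B.1 B.2, hreal hb hb0 B.1 B.2,
    ← integral_sub ha.integrableOn hb.integrableOn]
  calc _ ≤ ∫ x in B.1, |a x - b x| ∂L := by
        simpa only [Real.norm_eq_abs] using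
          norm_integral_le_integral_norm (μ := L.restrict B.1) fun x => a x - b x
    _ ≤ _ := setIntegral_le_integral (ha.sub hb).abs (ae_of_all _ fun x => abs_nonneg _)

lemma variationDist_nonneg {F : Type*} [MeasurableSpace F] (μ ν : Measure F) :
    0 ≤ variationDist μ ν :=
  Real.iSup_nonneg fun _ => abs_nonneg _

/-! ### The conditional density relative to the tilted law -/

lemma abs_gaussianPDFReal_sub_le (y : ℝ) :
    |gaussianPDFReal 0 1 y - gaussianPDFReal 0 1 0| ≤ gaussianPDFReal 0 1 0 * (y ^ 2 / 2) := by
  have h0 : 0 < gaussianPDFReal 0 1 0 := gaussianPDFReal_pos 0 1 0 one_ne_zero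
  have hy : gaussianPDFReal 0 1 y = gaussianPDFReal 0 1 0 * Real.exp (-(y ^ 2 / 2)) := by
    simp [gaussianPDFReal, neg_div]
  have h1 := Real.add_one_le_exp (-(y ^ 2 / 2))
  have h2 : Real.exp (-(y ^ 2 / 2)) ≤ 1 := Real.exp_le_one_iff.2 (by nlinarith [sq_nonneg y])
  rw [hy, abs_le]
  constructor <;> nlinarith

/-- The density of `n - 1` remaining summands at distance `x` from its mean, relative to the density
of all `n` summands at its mean, tends to one in `L¹` of the law of one summand. -/
lemma tendsto_integral_abs_ratio_sub_one {K : ℝ} {w : ℕ → ℝ → ℝ}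
    (hw : ∀ᶠ n in atTop, IsNormalizedDensity K (w n)) :
    (∀ᶠ n in atTop, 0 < convPow (w n) (n - 1) 0) ∧
    Tendsto (fun n => ∫ x, w n x * |convPow (w n) (n - 2) (-x) / convPow (w n) (n - 1) 0 - 1|)
      atTop (𝓝 0) := by
  obtain ⟨e, he, hne⟩ := exists_local_limit_bound hw tendsto_id
  have hpred : Tendsto (fun n : ℕ => n - 1) atTop atTop := tendsto_sub_atTop_nat 1
  obtain ⟨e', he', hne'⟩ := exists_local_limit_bound hw hpred
  set g₀ := gaussianPDFReal 0 1 0 with hg₀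
  have hg : 0 < g₀ := gaussianPDFReal_pos 0 1 0 one_ne_zero
  have hsmall : ∀ᶠ n in atTop, e n < g₀ / 2 := he.eventually (gt_mem_nhds (half_pos hg))
  have hB : ∀ᶠ n : ℕ in atTop, g₀ / 2 ≤ √n * convPow (w n) (n - 1) 0 := by
    filter_upwards [hne, hsmall] with n hn hs
    have h := hn 0
    simp only [id, mul_zero] at h
    have := (abs_le.1 h).1
    linarith
  have hk : Tendsto (fun n : ℕ => ((n - 1 : ℕ) : ℝ)) atTop atTop :=
    tendsto_natCast_atTop_atTop.comp hpred
  have hinv : Tendsto (fun n : ℕ => 1 / ((n - 1 : ℕ) : ℝ)) atTop (𝓝 0) := hk.const_div_atTop 1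
  -- `r n` is the ratio `√n / √(n - 1)` of the two normalizations
  set r : ℕ → ℝ := fun n => √(1 + 1 / ((n - 1 : ℕ) : ℝ)) with hr
  have hrlim : Tendsto r atTop (𝓝 1) := by
    have := (Real.continuous_sqrt.tendsto _).comp (hinv.const_add 1)
    rwa [add_zero, Real.sqrt_one] at this
  refine ⟨?_, ?_⟩
  · filter_upwards [hB, eventually_gt_atTop 0] with n hn hn0
    exact pos_of_mul_pos_right ((half_pos hg).trans_le hn) (Real.sqrt_nonneg _)
  set E : ℕ → ℝ := fun n =>
    (r n * (e' n + g₀ / 2 * (1 / ((n - 1 : ℕ) : ℝ))) + |r n - 1| * g₀ + e n) / (g₀ / 2) with hE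
  have hElim : Tendsto E atTop (𝓝 0) := by
    have h1 := hrlim.mul (he'.add (hinv.const_mul (g₀ / 2)))
    have h2 := ((hrlim.sub_const 1).abs).mul_const g₀
    have h3 := ((h1.add h2).add he).div_const (g₀ / 2)
    simpa only [mul_zero, add_zero, sub_self, abs_zero, zero_mul, zero_div] using h3
  refine squeeze_zero' ?_ ?_ hElim
  · filter_upwards [hw] with n hn
    exact integral_nonneg fun x => mul_nonneg (hn.nonneg x) (abs_nonneg _)
  filter_upwards [hw, hne, hne', hB, eventually_ge_atTop 2] with n hn h1 h2 hBn hn2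
  set k : ℝ := ((n - 1 : ℕ) : ℝ) with hkdef
  have hk0 : 0 < k := by rw [hkdef]; exact_mod_cast (by omega : 0 < n - 1)
  have hnk : (n : ℝ) = k + 1 := by rw [hkdef]; exact_mod_cast (by omega : n = n - 1 + 1)
  have hsk : 0 < √k := Real.sqrt_pos.2 hk0
  have hsn : √(n : ℝ) = r n * √k := by
    have : r n = √(1 + 1 / k) := rfl
    rw [this, ← Real.sqrt_mul (by positivity), hnk]
    congr 1
    field_simp
  have hr0 : 0 ≤ r n := Real.sqrt_nonneg _
  set B := √(n : ℝ) * convPow (w n) (n - 1) 0 with hBdef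
  have hB0 : 0 < B := (half_pos hg).trans_le hBn
  have hBe : |B - g₀| ≤ e n := by simpa [hBdef] using h1 0
  have hpt : ∀ x, |convPow (w n) (n - 2) (-x) / convPow (w n) (n - 1) 0 - 1| ≤
      (r n * (e' n + g₀ / 2 * (x ^ 2 / k)) + |r n - 1| * g₀ + e n) / (g₀ / 2) := by
    intro x
    set A := √k * convPow (w n) (n - 2) (-x) with hA
    have hAe : |A - gaussianPDFReal 0 1 (-x / √k)| ≤ e' n := by
      have h := h2 (-x / √k)
      rwa [mul_div_cancel₀ _ hsk.ne', Nat.sub_sub] at h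
    have hGe : |gaussianPDFReal 0 1 (-x / √k) - g₀| ≤ g₀ / 2 * (x ^ 2 / k) := by
      refine (abs_gaussianPDFReal_sub_le _).trans (le_of_eq ?_)
      rw [div_pow, Real.sq_sqrt hk0.le, neg_sq]
      ring
    have hAg : |A - g₀| ≤ e' n + g₀ / 2 * (x ^ 2 / k) :=
      (abs_sub_le _ _ _).trans (add_le_add hAe hGe)
    have hc0 : convPow (w n) (n - 1) 0 ≠ 0 := by
      intro h; rw [hBdef, h, mul_zero] at hB0; exact lt_irrefl _ hB0
    have hq : convPow (w n) (n - 2) (-x) / convPow (w n) (n - 1) 0 - 1 = (r n * A - B) / B := by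
      have hs0 : √(n : ℝ) ≠ 0 := by
        intro h; rw [hBdef, h, zero_mul] at hB0; exact lt_irrefl _ hB0
      have e1 : r n * A = √(n : ℝ) * convPow (w n) (n - 2) (-x) := by rw [hsn, hA]; ring
      rw [e1, sub_div, div_self hB0.ne', hBdef, mul_div_mul_left _ _ hs0]
    rw [hq, abs_div, abs_of_pos hB0]
    have hnum : |r n * A - B| ≤
        r n * (e' n + g₀ / 2 * (x ^ 2 / k)) + |r n - 1| * g₀ + e n := by
      have e2 : r n * A - B = r n * (A - g₀) + (r n - 1) * g₀ + (g₀ - B) := by ring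
      rw [e2]
      refine (abs_add_three _ _ _).trans ?_
      rw [abs_mul, abs_mul, abs_of_nonneg hr0, abs_of_pos hg, abs_sub_comm g₀ B]
      gcongr
    exact div_le_div₀ ((abs_nonneg _).trans hnum) hnum (half_pos hg) hBn
  have hi2 := hn.integrable_second
  have hdom : Integrable fun x => w n x *
      ((r n * e' n + |r n - 1| * g₀ + e n) / (g₀ / 2)) + w n x * x ^ 2 * (r n / k) :=
    (hn.integrable.mul_const _).add (hi2.mul_const _)
  calc _ ≤ ∫ x, (w n x * ((r n * e' n + |r n - 1| * g₀ + e n) / (g₀ / 2)) +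
        w n x * x ^ 2 * (r n / k)) := by
        refine integral_mono_of_nonneg
          (ae_of_all _ fun x => mul_nonneg (hn.nonneg x) (abs_nonneg _)) hdom
          (ae_of_all _ fun x => ?_)
        refine (mul_le_mul_of_nonneg_left (hpt x) (hn.nonneg x)).trans (le_of_eq ?_)
        field_simp
        ring
    _ = E n := by
        rw [integral_add (hn.integrable.mul_const _) (hi2.mul_const _), integral_mul_const,
          integral_mul_const, hn.integral_eq_one, hn.second]
        have : E n = (r n * (e' n + g₀ / 2 * (1 / k)) + |r n - 1| * g₀ + e n) / (g₀ / 2) := rfl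
        rw [this]
        field_simp
        ring

/-- The density proportional to `exp (t x) w(x)`, for a normalizing constant `c`. -/
noncomputable def tiltDensity (w : ℝ → ℝ) (t c : ℝ) : ℝ → ℝ := fun x => Real.exp (t * x) / c * w x

/-- For large tilts, the centred and normalized tilted densities stay in a fixed class. -/
lemma HasConvexTail.exists_isNormalizedDensity {Ω : Type*} [MeasurableSpace Ω] {P : Measure Ω}
    [IsProbabilityMeasure P] {Z : Ω → ℝ} {w g : ℝ → ℝ} {x₀ c₁ c₂ M : ℝ}
    (htail : HasConvexTail w g x₀ c₁ c₂) (hZ : Measurable Z) (hlaw : P.map Z = densMeasure w)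
    (hw : IsProbDensity w) (hM : ∀ x, w x ≤ M) :
    ∃ K t₀ : ℝ, ∀ a t, t₀ ≤ t → IsTiltParam P Z a t →
      IsProbDensity (tiltDensity w t (mgf Z P t)) ∧ ∃ s, 0 < s ∧
        IsNormalizedDensity K fun z => s * tiltDensity w t (mgf Z P t) (a + s * z) := by
  obtain ⟨K, t₀, henv⟩ := htail.exists_envelope hw hM
  obtain ⟨K', hK'⟩ := exists_isNormalizedDensity_of_envelope K
  refine ⟨K', max t₀ 0, fun a t ht hta => ?_⟩
  have ht0 : 0 ≤ t := (le_max_right _ _).trans ht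
  have hmgf : 0 < mgf Z P t := mgf_pos (interior_subset hta.1 : t ∈ integrableExpSet Z P)
  have hmgf' := mgf_eq_integral hZ hlaw hw t
  have hform : tiltDensity w t (mgf Z P t) = fun x => (mgf Z P t)⁻¹ * (Real.exp (t * x) * w x) := by
    ext x; rw [tiltDensity]; ring
  have hd : IsProbDensity (tiltDensity w t (mgf Z P t)) := by
    refine ⟨?_, fun x => ?_, ?_, ?_⟩
    · have := hw.measurable
      unfold tiltDensity
      fun_prop
    · exact mul_nonneg (by positivity) (hw.nonneg x)
    · rw [hform]; exact (htail.integrable_exp_mul hw ht0).const_mul _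
    · rw [hform, integral_const_mul, ← hmgf', inv_mul_cancel₀ hmgf.ne']
  refine ⟨hd, ?_⟩
  obtain ⟨b, σ, hσ, hle⟩ := henv t ((le_max_left _ _).trans ht)
  obtain ⟨s, hs, hn⟩ := hK' _ b σ hd hσ fun x => by
    rw [hform]
    simp only
    rw [inv_mul_le_iff₀ hmgf, mul_comm (mgf Z P t), hmgf']
    exact hle x
  have hmean : ∫ x, tiltDensity w t (mgf Z P t) x * x = a := by
    rw [← hta.2, deriv_cgf_eq_integral hZ hlaw hw hta.1]
    rfl
  rw [hmean] at hn
  exact ⟨s, hs, hn⟩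

section

variable {Ω E : Type*} [MeasurableSpace Ω] [MeasurableSpace E] {P : Measure Ω}
  {X : ℕ → Ω → E} {f : E → ℝ} {w : ℝ → ℝ} {M : ℝ}

/-- The law of one coordinate given the value `v` of the sum of `n` copies of `f(X)`, where `w` is
the density of `f(X)`: the remaining `n - 1` summands have density `convPow w (n - 2)` and must sum
to `v - f(x)`. It has this meaning for `n ≥ 2` only. -/
noncomputable def conditionalMargin (P : Measure Ω) (X : ℕ → Ω → E) (f : E → ℝ) (w : ℝ → ℝ)
    (n : ℕ) (v : ℝ) : Measure E :=
  (P.map (X 0)).withDensity fun x =>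
    ENNReal.ofReal (convPow w (n - 2) (v - f x) / convPow w (n - 1) v)

lemma integral_convPow_sub (hX : ∀ i, Measurable (X i)) (hf : Measurable f)
    (hlaw : P.map (fun ω => f (X 0 ω)) = densMeasure w) (hw : IsProbDensity w)
    (hM : ∀ x, w x ≤ M) {n : ℕ} (hn : 2 ≤ n) (v : ℝ) :
    ∫ y, convPow w (n - 2) (v - f y) ∂(P.map (X 0)) = convPow w (n - 1) v := by
  have hm := (hw.convPow hM (n - 2)).measurable
  have hmf : Measurable fun y => convPow w (n - 2) (v - f y) := hm.comp (measurable_const.sub hf)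
  rw [integral_map (hX 0).aemeasurable hmf.aestronglyMeasurable,
    integral_comp_eq_of_map_eq (Z := fun ω => f (X 0 ω)) (hf.comp (hX 0)) hlaw hw
    (F := fun z => convPow w (n - 2) (v - z))
    (hm.comp (measurable_const.sub measurable_id)).stronglyMeasurable]
  have : n - 1 = n - 2 + 1 := by omega
  rw [this]
  rfl

variable [IsProbabilityMeasure P]

lemma isCondLawAt_conditionalMargin (hX : ∀ i, Measurable (X i)) (hind : iIndepFun X P)
    (hident : ∀ i, P.map (X i) = P.map (X 0)) (hf : Measurable f)
    (hlaw : P.map (fun ω => f (X 0 ω)) = densMeasure w) (hw : IsProbDensity w)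
    (hM : ∀ x, w x ≤ M) {n : ℕ} (hn : 3 ≤ n) {v : ℝ} (hv : 0 < convPow w (n - 1) v) {i : ℕ}
    (hi : i < n) :
    IsCondLawAt P (X i) (fun ω => ∑ j ∈ Finset.range n, f (X j ω)) v
      (conditionalMargin P X f w n v) := by
  set S := (Finset.range n).erase i with hS
  have hmem : i ∈ Finset.range n := Finset.mem_range.2 hi
  have hcard : S.card = n - 2 + 1 := by
    rw [hS, Finset.card_erase_of_mem hmem, Finset.card_range]; omega
  have hlawi : ∀ j, P.map (fun ω => f (X j ω)) = densMeasure w := by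
    intro j
    rw [← hlaw]
    change P.map (f ∘ X j) = P.map (f ∘ X 0)
    rw [← Measure.map_map hf (hX j), ← Measure.map_map hf (hX 0), hident j]
  have hT : P.map (fun ω => ∑ j ∈ S, f (X j ω)) = densMeasure (convPow w (n - 2)) :=
    map_sum_eq_densMeasure_convPow (Z := fun j ω => f (X j ω)) (fun j => hf.comp (hX j))
      (hind.comp (fun _ => f) fun _ => hf) hw hM hlawi (n - 2) S hcard
  have hI : IndepFun (X i) (fun ω => ∑ j ∈ S, f (X j ω)) P := by
    have h := hind.indepFun_finset {i} S (by simp [hS]) hX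
    have hφ : Measurable fun z : ({i} : Finset ℕ) → E => z ⟨i, Finset.mem_singleton_self i⟩ :=
      measurable_pi_apply _
    have hψ : Measurable fun z : S → E => ∑ j, f (z j) := by fun_prop
    have h2 := h.comp hφ hψ
    have h3 : (fun ω => ∑ j ∈ S, f (X j ω)) = fun ω => ∑ j : S, f (X j ω) := by
      ext ω
      exact (Finset.sum_coe_sort S fun j => f (X j ω)).symm
    rw [h3]
    exact h2
  -- with at least two remaining summands their density is continuous
  obtain ⟨k, hk⟩ : ∃ k, n - 2 = k + 1 := ⟨n - 3, by omega⟩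
  have hcont : Continuous (convPow w (n - 2)) := by
    rw [hk]; exact hw.continuous_convPow hM k
  have hint := integral_convPow_sub hX hf hlaw hw hM (by omega : 2 ≤ n) v
  have hmain := isCondLawAt_of_density (v := v) (hX i) (by fun_prop) hf hI hT hcont
    (hw.convPow hM _).nonneg (hw.convPow_le hM _) (by rw [hident i, hint]; exact hv)
  rw [hident i, hint] at hmain
  have hsum : (fun ω => ∑ j ∈ Finset.range n, f (X j ω)) =
      fun ω => f (X i ω) + ∑ j ∈ S, f (X j ω) := by
    ext ω
    exact (Finset.add_sum_erase _ (fun j => f (X j ω)) hmem).symm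
  rw [hsum]
  exact hmain

/-- The variation distance between the conditional margin and a tilted law, expressed through
the normalized tilted density. -/
lemma variationDist_conditionalMargin_le (hX : ∀ i, Measurable (X i)) (hf : Measurable f)
    (hlaw : P.map (fun ω => f (X 0 ω)) = densMeasure w) (hw : IsProbDensity w)
    (hM : ∀ x, w x ≤ M) {n : ℕ} (hn : 2 ≤ n) {t c a s : ℝ} (hc : 0 < c) (hs : 0 < s)
    (hd : IsProbDensity (tiltDensity w t c)) (hv : 0 < convPow w (n - 1) (n * a)) :
    variationDist (conditionalMargin P X f w n (n * a))
      ((P.map (X 0)).withDensity fun x => ENNReal.ofReal (Real.exp (t * f x) / c)) ≤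
    ∫ x, s * tiltDensity w t c (a + s * x) *
      |convPow (fun z => s * tiltDensity w t c (a + s * z)) (n - 2) (-x) /
        convPow (fun z => s * tiltDensity w t c (a + s * z)) (n - 1) 0 - 1| := by
  have hm := (hw.convPow hM (n - 2)).measurable
  have hwm := hw.measurable
  have hZ : Measurable fun ω => f (X 0 ω) := hf.comp (hX 0)
  have hP0 : IsProbabilityMeasure (P.map (X 0)) :=
    Measure.isProbabilityMeasure_map (hX 0).aemeasurable
  set D := convPow w (n - 1) (n * a) with hD
  have hmf : Measurable fun x => convPow w (n - 2) (n * a - f x) :=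
    hm.comp (measurable_const.sub hf)
  have hmz : Measurable fun z : ℝ => convPow w (n - 2) (n * a - z) :=
    hm.comp (measurable_const.sub measurable_id)
  have hai : Integrable (fun x => convPow w (n - 2) (n * a - f x) / D) (P.map (X 0)) := by
    refine (Integrable.of_bound (C := M) hmf.aestronglyMeasurable
      (ae_of_all _ fun x => ?_)).div_const D
    rw [Real.norm_eq_abs, abs_of_nonneg ((hw.convPow hM _).nonneg _)]
    exact hw.convPow_le hM _ _
  have hbi : Integrable (fun x => Real.exp (t * f x) / c) (P.map (X 0)) := by
    have h1 : Integrable (fun z => Real.exp (t * z) / c) (P.map fun ω => f (X 0 ω)) := by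
      rw [hlaw, integrable_densMeasure_iff hw.measurable hw.nonneg]
      refine hd.integrable.congr (ae_of_all _ fun x => ?_)
      rw [tiltDensity, mul_comm]
    rw [integrable_map_measure (by fun_prop) (hX 0).aemeasurable]
    exact h1.comp_measurable hZ
  refine (variationDist_withDensity_le hai hbi
    (fun x => div_nonneg ((hw.convPow hM _).nonneg _) hv.le)
    (fun x => by positivity)).trans (le_of_eq ?_)
  have hmF : Measurable fun x => |convPow w (n - 2) (n * a - f x) / D - Real.exp (t * f x) / c| :=
    ((hmf.div_const D).sub (by fun_prop)).abs
  have hmG : Measurable fun z => |convPow w (n - 2) (n * a - z) / D - Real.exp (t * z) / c| :=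
    ((hmz.div_const D).sub (by fun_prop)).abs
  rw [integral_map (hX 0).aemeasurable hmF.aestronglyMeasurable,
    integral_comp_eq_of_map_eq (Z := fun ω => f (X 0 ω)) hZ hlaw hw
    (F := fun z => |convPow w (n - 2) (n * a - z) / D - Real.exp (t * z) / c|)
    hmG.stronglyMeasurable,
    ← integral_mul_comp_affine (fun z => w z •
      |convPow w (n - 2) (n * a - z) / D - Real.exp (t * z) / c|) hs a]
  congr 1; ext x
  obtain ⟨k, rfl⟩ : ∃ k, n = k + 2 := ⟨n - 2, by omega⟩
  have e1 : k + 2 - 2 = k := rfl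
  have e2 : k + 2 - 1 = k + 1 := rfl
  rw [e1, e2, convPow_affine _ hs, convPow_affine _ hs]
  have htilt : ∀ j y, convPow (tiltDensity w t c) j y =
      Real.exp (t * y) / c ^ (j + 1) * convPow w j y := fun j y => convPow_tilt w t c j y
  have harg : ((k + 2 : ℕ) : ℝ) * a - (a + s * x) = (k + 1) * a + s * -x := by push_cast; ring
  have harg2 : ((k + 1 : ℕ) + 1 : ℝ) * a + s * 0 = ((k + 2 : ℕ) : ℝ) * a := by push_cast; ring
  have hexp : Real.exp (t * (((k + 2 : ℕ) : ℝ) * a)) =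
      Real.exp (t * ((k + 1) * a + s * -x)) * Real.exp (t * (a + s * x)) := by
    rw [← Real.exp_add]; congr 1; push_cast; ring
  rw [htilt, htilt, harg2, hexp]
  simp only [e2, harg, smul_eq_mul] at hD ⊢
  rw [← hD, tiltDensity]
  have hE := Real.exp_pos (t * ((k + 1) * a + s * -x))
  have hE' := Real.exp_pos (t * (a + s * x))
  generalize Real.exp (t * ((k + 1) * a + s * -x)) = A at *
  generalize Real.exp (t * (a + s * x)) = B at *
  generalize convPow w k ((k + 1) * a + s * -x) = C
  have hratio : s * (A / c ^ (k + 1) * C) / (s * (A * B / c ^ (k + 1 + 1) * D)) - 1 =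
      c / B * (C / D - B / c) := by
    rw [pow_succ c (k + 1)]
    field_simp
  rw [hratio, abs_mul, abs_of_pos (div_pos hc hE')]
  field_simp

end

end GibbsConditioning

open GibbsConditioning in
theorem mainTheorem4
    {Ω : Type*} [MeasurableSpace Ω] (P : Measure Ω) [IsProbabilityMeasure P]
    (d : ℕ) (X : ℕ → Ω → EuclideanSpace ℝ (Fin d))
    (p : EuclideanSpace ℝ (Fin d) → ℝ) (f : EuclideanSpace ℝ (Fin d) → ℝ)
    (pf g q : ℝ → ℝ) (a : ℕ → ℝ)
    -- the `X i` are i.i.d. with density `p` on `ℝ^d`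
    (hX : ∀ i, Measurable (X i)) (hindep : iIndepFun X P)
    (hp : Measurable p) (hp_nonneg : ∀ x, 0 ≤ p x)
    (hX_law : ∀ i, P.map (X i) = volume.withDensity (fun x => ENNReal.ofReal (p x)))
    -- `f (X 0)` has the light-tailed density `pf`, and its moment generating function is finite
    -- in a neighbourhood of zero
    (hf : Measurable f)
    (hfX_law : P.map (fun ω => f (X 0 ω)) = volume.withDensity (fun y => ENNReal.ofReal (pf y)))
    (hpf : IsLightTailDensity pf g q)
    (hmgf : (0 : ℝ) ∈ interior (integrableExpSet (fun ω => f (X 0 ω)) P))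
    -- `a n → ∞`, with the growth condition `ψ(t)² / √(n ψ'(t)) → 0` along `t = t_n`
    (ha : Tendsto a atTop atTop)
    (ha_growth : Tendsto (fun n : ℕ =>
        genInverse (deriv g) (tiltParam P (fun ω => f (X 0 ω)) (a n)) ^ 2 /
          √(n * deriv (genInverse (deriv g)) (tiltParam P (fun ω => f (X 0 ω)) (a n))))
      atTop (𝓝 0)) :
    -- for large `n` the tilting parameter is well defined
    (∀ᶠ n in atTop, ∃! t : ℝ, IsTiltParam P (fun ω => f (X 0 ω)) (a n) t) ∧
    -- for large `n` the coordinates of `(X 0, …, X (n - 1))` have a common conditional law `ν n`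
    -- given `∑ i < n, f (X i) = n a_n`, and it is asymptotically the tilted law
    ∃ ν : ℕ → Measure (EuclideanSpace ℝ (Fin d)),
      (∀ᶠ n in atTop, ∀ i < n,
        IsCondLawAt P (X i) (fun ω => ∑ j ∈ Finset.range n, f (X j ω)) (n * a n) (ν n)) ∧
      Tendsto (fun n => variationDist (ν n) (tiltedLaw P (fun ω => f (X 0 ω)) f p (a n)))
        atTop (𝓝 0) := by
  have hZ : Measurable fun ω => f (X 0 ω) := hf.comp (hX 0)
  have hlaw : P.map (fun ω => f (X 0 ω)) = densMeasure pf := hfX_law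
  have hpd : IsProbDensity pf := by
    refine isProbDensity_of_isProbabilityMeasure hpf.measurable hpf.nonneg ?_
    rw [← hlaw]
    exact Measure.isProbabilityMeasure_map hZ.aemeasurable
  obtain ⟨M, hM⟩ := hpf.bounded
  obtain ⟨x₀, c₁, c₂, htail⟩ := exists_hasConvexTail hpf
  have hident : ∀ i, P.map (X i) = P.map (X 0) := fun i => by rw [hX_law i, hX_law 0]
  have hexist : ∀ᶠ n in atTop, ∃! t : ℝ, IsTiltParam P (fun ω => f (X 0 ω)) (a n) t := by
    filter_upwards [ha.eventually_ge_atTop (deriv (cgf (fun ω => f (X 0 ω)) P) 0)] with n hn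
    exact htail.existsUnique_isTiltParam hZ hlaw hpd hmgf hn
  refine ⟨hexist, ?_⟩
  set t : ℕ → ℝ := fun n => tiltParam P (fun ω => f (X 0 ω)) (a n) with ht
  set φ : ℕ → ℝ := fun n => mgf (fun ω => f (X 0 ω)) P (t n) with hφ
  obtain ⟨K, t₀, hK⟩ := htail.exists_isNormalizedDensity hZ hlaw hpd hM
  have htlim : Tendsto t atTop atTop := (htail.tendsto_tiltParam hZ hlaw hpd hmgf).comp ha
  have hgood : ∀ᶠ n in atTop, IsTiltParam P (fun ω => f (X 0 ω)) (a n) (t n) ∧ t₀ ≤ t n := by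
    filter_upwards [hexist, htlim.eventually_ge_atTop t₀] with n h1 h2
    exact ⟨isTiltParam_tiltParam h1, h2⟩
  -- scales for the tilted densities, with an arbitrary value for the finitely many bad `n`
  have hscale : ∀ n, ∃ s : ℝ, IsTiltParam P (fun ω => f (X 0 ω)) (a n) (t n) ∧ t₀ ≤ t n →
      0 < s ∧ IsNormalizedDensity K fun z => s * tiltDensity pf (t n) (φ n) (a n + s * z) := by
    intro n
    by_cases h : IsTiltParam P (fun ω => f (X 0 ω)) (a n) (t n) ∧ t₀ ≤ t n
    · obtain ⟨s, hs⟩ := (hK _ _ h.2 h.1).2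
      exact ⟨s, fun _ => hs⟩
    · exact ⟨0, fun h' => absurd h' h⟩
  choose s hs using hscale
  obtain ⟨hpos, hlim⟩ := tendsto_integral_abs_ratio_sub_one
    (w := fun n z => s n * tiltDensity pf (t n) (φ n) (a n + s n * z))
    (by filter_upwards [hgood] with n hn using (hs n hn).2)
  have hφpos : ∀ᶠ n in atTop, 0 < φ n := by
    filter_upwards [hgood] with n hn
    exact mgf_pos (interior_subset hn.1.1 : t n ∈ integrableExpSet _ P)
  -- positivity of the density of the sum transfers from the tilted to the original variables
  have hD : ∀ᶠ n : ℕ in atTop, 0 < convPow pf (n - 1) (n * a n) := by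
    filter_upwards [hpos, hgood, hφpos, eventually_ge_atTop 1] with n h1 h2 h3 h4
    have h5 : convPow (tiltDensity pf (t n) (φ n)) (n - 1) (((n - 1 : ℕ) + 1 : ℝ) * a n + s n * 0) =
        Real.exp (t n * (((n - 1 : ℕ) + 1 : ℝ) * a n + s n * 0)) / φ n ^ (n - 1 + 1) *
          convPow pf (n - 1) (((n - 1 : ℕ) + 1 : ℝ) * a n + s n * 0) := convPow_tilt _ _ _ _ _
    have h6 : (((n - 1 : ℕ) + 1 : ℝ) * a n + s n * 0) = n * a n := by
      rw [mul_zero, add_zero]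
      congr 1
      exact_mod_cast Nat.sub_add_cancel h4
    rw [convPow_affine _ (hs n h2).1, h5, h6] at h1
    exact pos_of_mul_pos_right (pos_of_mul_pos_right h1 (hs n h2).1.le) (by positivity)
  refine ⟨fun n => conditionalMargin P X f pf n (n * a n), ?_, ?_⟩
  · filter_upwards [hD, eventually_ge_atTop 3] with n hn hn3 i hi
    exact isCondLawAt_conditionalMargin hX hindep hident hf hlaw hpd hM hn3 hn hi
  · refine squeeze_zero' (Eventually.of_forall fun n => variationDist_nonneg _ _) ?_ hlim
    filter_upwards [hD, hgood, hφpos, eventually_ge_atTop 2] with n h1 h2 h3 h4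
    have hlawtilt : tiltedLaw P (fun ω => f (X 0 ω)) f p (a n) =
        (P.map (X 0)).withDensity fun x => ENNReal.ofReal (Real.exp (t n * f x) / φ n) := by
      rw [hX_law 0, ← withDensity_mul _ (by fun_prop) (by fun_prop), tiltedLaw]
      congr 1
      ext x
      rw [Pi.mul_apply, ← ENNReal.ofReal_mul (hp_nonneg x), mul_comm]
    rw [hlawtilt]
    exact variationDist_conditionalMargin_le hX hf hlaw hpd hM h4 h3 (hs n h2).1
      (hK _ _ h2.2 h2.1).1 h1
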